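/- For a metric space $(M,d)$ and a Banach space $X$ let $Lip(M,X)$ be the space of Lipschitz functions $f:M\to X$ with the seminorm $L(f)=\sup_{m\ne m'}\|f(m)-f(m')\|/d(m,m')$. For $S\subset M$ (with the induced metric) let $\lambda(S,M;X)$ be the infimum of the norms $\|T\|$ over all continuous linear operators $T:Lip(S,X)\to Lip(M,X)$ with $Tf|_S=f$ for all $f$ (and $\infty$ if there is none). Write $B_R(m)$ for the open ball of radius $R$ centred at $m$. A metric space $(M,d)$ is of pointwise homogeneous type with respect to a family $\{\mu_m\}_{m\in M}$ of Borel measures on $M$ if every ball $B_R(m)$, $m\in M$, $R>0$, has finite and strictly positive $\mu_m$-measure, $$D:=\sup_{m\in M}\sup_{R>0}\frac{\mu_m(B_{2R}(m))}{\mu_m(B_R(m))}<\infty ,$$ and for some constant $C\ge 0$, for all $m_1,m_2\in M$ and $R>0$, $$|\mu_{m_1}-\mu_{m_2}|(B_R(m))\le C\,\frac{\mu_m(B_R(m))}{R}\,d(m_1,m_2)\qquad\text{for } m=m_1 \text{ and for } m=m_2 ,$$ where $|\cdot|$ is the total variation. The least such $C$ is the consistency constant and $D$ is the doubling constant of the family.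 The family is $K$-uniform ($K\ge 1$) if $\mu_{m_1}(B_R(m_1))\le K\mu_{m_2}(B_R(m_2))$ for all $m_1,m_2\in M$ and $R>0$. **Theorem.** There is a numerical constant $c_0>0$ such that the following holds. (1) Let $1\le p\le\infty$, $\frac1p+\frac1q=1$, and for $1\le i\le N$ let $(M_i,d_i)$ be of pointwise homogeneous type with respect to a $K_i$-uniform family of Borel measures with doubling constant $D_i$ and consistency constant $C_i$. Let $M=\prod_{i=1}^N M_i$ with the metric $d_p(m,m')=\big(\sum_{i=1}^N d_i(m_i,m_i')^p\big)^{1/p}$ (the maximum of the $d_i(m_i,m_i')$ if $p=\infty$). Then for every $S\subset M$ and every Banach space $X$ $$\lambda(S,M;X)\le c_0(\widetilde C_p+1)(\log_2\widetilde D+1),\qquad \widetilde D=\prod_{i=1}^N D_i,\quad \widetilde C_p=\Big(\sum_{i=1}^N C_i^q\Big)^{1/q}\prod_{i=1}^N K_i ,$$ where $(\sum_i C_i^q)^{1/q}$ means $\max_i C_i$ if $q=\infty$. (2) If $(M,d)$ is of pointwise homogeneous type with respect to a family of Borel measures (not assumed uniform) with doubling constant $D$ and consistency constant $C$, then for every $S\subset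 M$ and every Banach space $X$ $$\lambda(S,M;X)\le c_0(C+1)(\log_2 D+1).$$ -/

import Mathlib

open MeasureTheory Metric
open scoped NNReal ENNReal

universe u v w

noncomputable section

/-! ### Spaces of Lipschitz functions and the extension constant -/

/-- The space of Lipschitz functions from `M` to `X`, as a subspace of all functions. -/
def lipSubmodule (𝕜 M X : Type*) [RCLike 𝕜] [MetricSpace M] [NormedAddCommGroup X]
    [NormedSpace 𝕜 X] : Submodule 𝕜 (M → X) where
  carrier := {f | ∃ K : ℝ≥0, LipschitzWith K f}
  add_mem' := by
    rintro f g ⟨K, hf⟩ ⟨L, hg⟩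
    exact ⟨K + L, hf.add hg⟩
  zero_mem' := ⟨0, LipschitzWith.const 0⟩
  smul_mem' := by
    rintro c f ⟨K, hf⟩
    refine ⟨‖c‖₊ * K, LipschitzWith.of_dist_le_mul fun x y => ?_⟩
    have h := hf.dist_le_mul x y
    rw [Pi.smul_apply, Pi.smul_apply, dist_smul₀, NNReal.coe_mul, coe_nnnorm, mul_assoc]
    exact mul_le_mul_of_nonneg_left h (norm_nonneg c)

/-- `Lip(M, X)`. It is a separate type so that its topology is the one given by the Lipschitz
seminorm and not the topology of pointwise convergence. -/
def Lip (𝕜 M X : Type*) [RCLike 𝕜] [MetricSpace M] [NormedAddCommGroup X]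
    [NormedSpace 𝕜 X] : Type _ :=
  ↥(lipSubmodule 𝕜 M X)

namespace Lip

variable {𝕜 M X : Type*} [RCLike 𝕜] [MetricSpace M] [NormedAddCommGroup X] [NormedSpace 𝕜 X]

instance : CoeFun (Lip 𝕜 M X) fun _ => M → X :=
  ⟨fun f => f.1⟩

instance : AddCommGroup (Lip 𝕜 M X) :=
  inferInstanceAs (AddCommGroup ↥(lipSubmodule 𝕜 M X))

instance : Module 𝕜 (Lip 𝕜 M X) :=
  inferInstanceAs (Module 𝕜 ↥(lipSubmodule 𝕜 M X))

/-- The Lipschitz constant `L(f) = sup_{m ≠ m'} ‖f m - f m'‖ / d(m, m')`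
(equal to `0` if `M` has at most one point). -/
def lipConst (f : Lip 𝕜 M X) : ℝ :=
  ⨆ p : {p : M × M // p.1 ≠ p.2}, ‖f p.1.1 - f p.1.2‖ / dist p.1.1 p.1.2

theorem bddAbove_quotients (f : Lip 𝕜 M X) :
    BddAbove (Set.range fun p : {p : M × M // p.1 ≠ p.2} =>
      ‖f p.1.1 - f p.1.2‖ / dist p.1.1 p.1.2) := by
  obtain ⟨K, hK⟩ := f.2
  refine ⟨K, ?_⟩
  rintro _ ⟨p, rfl⟩
  have h := hK.dist_le_mul p.1.1 p.1.2
  rw [dist_eq_norm] at h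
  exact (div_le_iff₀ (dist_pos.2 p.2)).2 h

theorem lipConst_nonneg (f : Lip 𝕜 M X) : 0 ≤ lipConst f :=
  Real.iSup_nonneg fun _ => div_nonneg (norm_nonneg _) dist_nonneg

theorem lipConst_add_le (f g : Lip 𝕜 M X) : lipConst (f + g) ≤ lipConst f + lipConst g := by
  refine Real.iSup_le (fun p => ?_) (add_nonneg (lipConst_nonneg f) (lipConst_nonneg g))
  refine le_trans ?_
    (add_le_add (le_ciSup (bddAbove_quotients f) p) (le_ciSup (bddAbove_quotients g) p))
  rw [← add_div]
  refine div_le_div_of_nonneg_right ?_ dist_nonneg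
  change ‖(f p.1.1 + g p.1.1) - (f p.1.2 + g p.1.2)‖ ≤ _
  rw [add_sub_add_comm]
  exact norm_add_le _ _

theorem lipConst_smul (c : 𝕜) (f : Lip 𝕜 M X) : lipConst (c • f) = ‖c‖ * lipConst f := by
  unfold lipConst
  rw [Real.mul_iSup_of_nonneg (norm_nonneg c)]
  congr 1
  funext p
  change ‖c • f p.1.1 - c • f p.1.2‖ / _ = _
  rw [← smul_sub, norm_smul, mul_div_assoc]

/-- `L` as a seminorm on `Lip(M, X)`. -/
def lipSeminorm (𝕜 M X : Type*) [RCLike 𝕜] [MetricSpace M] [NormedAddCommGroup X]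
    [NormedSpace 𝕜 X] : Seminorm 𝕜 (Lip 𝕜 M X) :=
  Seminorm.of lipConst lipConst_add_le lipConst_smul

instance : SeminormedAddCommGroup (Lip 𝕜 M X) :=
  (lipSeminorm 𝕜 M X).toAddGroupSeminorm.toSeminormedAddCommGroup

instance : NormedSpace 𝕜 (Lip 𝕜 M X) where
  norm_smul_le c f := (lipConst_smul c f).le

end Lip

/-- `Ext(S, M; X)`: the simultaneous Lipschitz extensions from `S` to `M`, that is, the continuous
linear operators `T : Lip(S, X) → Lip(M, X)` with `T f = f` on `S`. -/
def lipExtensions (𝕜 : Type*) {M : Type*} (X : Type*) [RCLike 𝕜] [MetricSpace M]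
    [NormedAddCommGroup X] [NormedSpace 𝕜 X] (S : Set M) :
    Set (Lip 𝕜 S X →L[𝕜] Lip 𝕜 M X) :=
  {T | ∀ (f : Lip 𝕜 S X) (s : S), T f (s : M) = f s}

/-- The extension constant `λ(S, M; X) = inf {‖T‖ : T ∈ Ext(S, M; X)}`, which is `∞` if there is no
simultaneous Lipschitz extension. -/
def extensionConst (𝕜 : Type*) {M : Type*} (X : Type*) [RCLike 𝕜] [MetricSpace M]
    [NormedAddCommGroup X] [NormedSpace 𝕜 X] (S : Set M) : ℝ≥0∞ :=
  ⨅ T ∈ lipExtensions 𝕜 X S, ENNReal.ofReal ‖T‖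

/-! ### Spaces of pointwise homogeneous type -/

section Measures

variable {M : Type*} [MetricSpace M] [MeasurableSpace M]

/-- `D_m(μ) = sup_{R > 0} μ(B_{2R}(m)) / μ(B_R(m))`. -/
def doublingConstAt (μ : Measure M) (m : M) : ℝ≥0∞ :=
  ⨆ (R : ℝ) (_ : 0 < R), μ (ball m (2 * R)) / μ (ball m R)

/-- `μ` is doubling at `m`. -/
structure IsDoublingAt (μ : Measure M) (m : M) : Prop where
  pos : ∀ R : ℝ, 0 < R → 0 < μ (ball m R)
  finite : ∀ R : ℝ, 0 < R → μ (ball m R) < ⊤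
  doubling : doublingConstAt μ m < ⊤

/-- The uniform doubling constant `D = sup_m D_m(μ_m)` of a family of measures. -/
def doublingConst (μ : M → Measure M) : ℝ≥0∞ :=
  ⨆ m, doublingConstAt (μ m) m

/-- `|μ - ν|(A)`, the total variation of `μ - ν` on `A`. Here the truncated differences `μ - ν` and
`ν - μ` of measures are the positive and the negative part in the Jordan decomposition. -/
def variationDiff (μ ν : Measure M) (A : Set M) : ℝ≥0∞ :=
  (μ - ν) A + (ν - μ) A

/-- Consistency with the metric with constant `C`: for all `m₁, m₂`, all `R > 0` and both `m = m₁`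
and `m = m₂`, `|μ_{m₁} - μ_{m₂}|(B_R(m)) ≤ C (μ_m(B_R(m)) / R) d(m₁, m₂)`. -/
def IsConsistentWith (μ : M → Measure M) (C : ℝ≥0) : Prop :=
  ∀ (m₁ m₂ m : M) (R : ℝ), m = m₁ ∨ m = m₂ → 0 < R →
    variationDiff (μ m₁) (μ m₂) (ball m R) ≤
      C * (μ m (ball m R) / ENNReal.ofReal R) * edist m₁ m₂

/-- The optimal consistency constant of a family of measures. -/
def consistencyConst (μ : M → Measure M) : ℝ≥0 :=
  sInf {C : ℝ≥0 | IsConsistentWith μ C}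

/-- `M` is of pointwise homogeneous type with respect to the family `μ`. -/
structure IsPointwiseHomogeneous (μ : M → Measure M) : Prop where
  doublingAt : ∀ m, IsDoublingAt (μ m) m
  uniform_doubling : doublingConst μ < ⊤
  consistent : ∃ C : ℝ≥0, IsConsistentWith μ C

/-- `K`-uniformity of a family of measures. -/
def IsUniformFamily (μ : M → Measure M) (K : ℝ≥0) : Prop :=
  ∀ (m₁ m₂ : M) (R : ℝ), 0 < R → μ m₁ (ball m₁ R) ≤ K * μ m₂ (ball m₂ R)

end Measures

end

/-!
For a point `y` off the closure of `S`, put `R = d(y, S) / 16` and give the points at distance `σ R`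
from `y` a weight proportional to `exp (-b σ)`, cut off at `σ = 3`, with respect to the measure
attached to `y`. With `b = log₂ D + 1` the decay beats the growth of the balls, so that the
normalised weights form a probability measure near `y` which varies in a Lipschitz way with `y`: at
a small distance `δ` of two points, the two measures have a common upper bound of total mass
`1 + O((C + 1) b δ / d(y, S))`.

Averaging the values of `f` at nearby points of `S` against these measures extends `f`. Choosing the
point of `S` measurably may be impossible in a non-separable space, so the choice is made only once
for each member of a maximal family of mutually singular measures concentrated near some point; the
value there is weighted by the mass of the absolutely continuous part.

On a product, the measure attached to `y` is the product of the measures attached to its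
coordinates. The consistency condition is too weak on small balls of a single factor. Therefore the
distance in the `i`-th coordinate is reduced by `ℓᵢ R`, where `ℓᵢ = log₂ Dᵢ / b`: now only balls of
radius at least `ℓᵢ R` of the `i`-th factor matter, `∑ ℓᵢ ≤ 1` keeps the kernel near `y`, and
`Dᵢ ≥ √2` for a factor with two points, whence `1 / ℓᵢ ≤ 2 b`. Hölder's inequality then bounds
`∑ Cᵢ d(xᵢ, yᵢ)`.
-/

noncomputable section

section CarrierMass

variable {Ω : Type*} [MeasurableSpace Ω]

/-- The smallest `κ`-mass of a set carrying `j`, that is, the total mass of the part of `κ` that is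
absolutely continuous with respect to `j`. -/
def carrierMass (j κ : Measure Ω) : ℝ≥0∞ :=
  ⨅ A ∈ ae j, κ A

theorem carrierMass_le {j : Measure Ω} {A : Set Ω} (hA : A ∈ ae j) (κ : Measure Ω) :
    carrierMass j κ ≤ κ A :=
  iInf₂_le A hA

theorem carrierMass_mono (j : Measure Ω) {κ κ' : Measure Ω} (h : κ ≤ κ') :
    carrierMass j κ ≤ carrierMass j κ' :=
  iInf₂_mono fun A _ => h A

theorem exists_measurableSet_eq_carrierMass (j κ : Measure Ω) :
    ∃ A, MeasurableSet A ∧ A ∈ ae j ∧ κ A = carrierMass j κ := by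
  have hne : (κ '' (ae j).sets).Nonempty := ⟨κ Set.univ, Set.univ, Filter.univ_mem, rfl⟩
  obtain ⟨u, -, hu, hu_mem⟩ := exists_seq_tendsto_sInf hne (OrderBot.bddBelow _)
  rw [sInf_image] at hu
  choose A hA hκA using hu_mem
  have hinter : ⋂ n, A n ∈ ae j := countable_iInter_mem.2 hA
  obtain ⟨B, hB, hBm, hBA⟩ := Filter.IsMeasurablyGenerated.exists_measurable_subset hinter
  refine ⟨B, hBm, hB, le_antisymm (ge_of_tendsto' hu fun n => ?_) (carrierMass_le hB κ)⟩
  exact (hκA n).symm ▸ measure_mono (hBA.trans (Set.iInter_subset A n))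

theorem mutuallySingular_of_carrierMass_eq_zero {j κ : Measure Ω} (h : carrierMass j κ = 0) :
    κ.MutuallySingular j := by
  obtain ⟨A, hA, hj, hκ⟩ := exists_measurableSet_eq_carrierMass j κ
  exact ⟨A, hA, hκ.trans h, hj⟩

theorem carrierMass_le_restrict {j : Measure Ω} {A : Set Ω} (hA : MeasurableSet A) (hj : A ∈ ae j)
    (κ : Measure Ω) : carrierMass j κ ≤ carrierMass j (κ.restrict A) :=
  le_iInf₂ fun B hB => by
    rw [Measure.restrict_apply' hA]
    exact carrierMass_le (Filter.inter_mem hB hj) κ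

theorem sum_carrierMass_le (J : Finset (Measure Ω))
    (hJ : (J : Set (Measure Ω)).Pairwise Measure.MutuallySingular) (κ : Measure Ω) :
    ∑ j ∈ J, carrierMass j κ ≤ κ Set.univ := by
  classical
  induction J using Finset.induction_on generalizing κ with
  | empty => simp
  | insert j J hj ih =>
    rw [Finset.coe_insert] at hJ
    have hsing : ∀ i : J, Measure.MutuallySingular i.1 j := fun i =>
      hJ (Set.mem_insert_of_mem j i.2) (Set.mem_insert j _) (ne_of_mem_of_not_mem i.2 hj)
    obtain ⟨A, hA, hAJ, hAj⟩ := Measure.MutuallySingular.sum_left.2 hsing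
    have hcarrier : ∀ i ∈ J, Aᶜ ∈ ae i := fun i hi => by
      rw [Measure.sum_apply _ hA, ENNReal.tsum_eq_zero] at hAJ
      exact compl_mem_ae_iff.2 (hAJ ⟨i, hi⟩)
    calc ∑ i ∈ insert j J, carrierMass i κ
        = carrierMass j κ + ∑ i ∈ J, carrierMass i κ := Finset.sum_insert hj
      _ ≤ κ A + ∑ i ∈ J, carrierMass i (κ.restrict Aᶜ) :=
          add_le_add (carrierMass_le hAj κ)
            (Finset.sum_le_sum fun i hi => carrierMass_le_restrict hA.compl (hcarrier i hi) κ)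
      _ ≤ κ A + κ.restrict Aᶜ Set.univ := by
          gcongr
          exact ih (hJ.mono (Set.subset_insert _ _)) _
      _ = κ Set.univ := by rw [Measure.restrict_apply_univ, measure_add_measure_compl hA]

theorem tsum_carrierMass_le {J : Set (Measure Ω)} (hJ : J.Pairwise Measure.MutuallySingular)
    (κ : Measure Ω) : ∑' j : J, carrierMass j.1 κ ≤ κ Set.univ := by
  rw [ENNReal.tsum_eq_iSup_sum]
  refine iSup_le fun s => ?_
  have hs : ↑(s.map (Function.Embedding.subtype (· ∈ J))) ⊆ J := by simp
  simpa using sum_carrierMass_le _ (hJ.mono hs) κ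

/-- The family `J` is a maximal mutually singular subfamily of the class `𝒞`, in the form in which
maximality is used: a member of `𝒞` that is singular to all of `J` vanishes. -/
structure IsMaximalMutuallySingular (𝒞 J : Set (Measure Ω)) : Prop where
  subset : J ⊆ 𝒞
  pairwise : J.Pairwise Measure.MutuallySingular
  eq_zero : ∀ κ ∈ 𝒞, (∀ j ∈ J, κ.MutuallySingular j) → κ = 0

theorem exists_isMaximalMutuallySingular (𝒞 : Set (Measure Ω)) :
    ∃ J, IsMaximalMutuallySingular 𝒞 J := by
  obtain ⟨J, hJ⟩ := zorn_subset {J | J ⊆ 𝒞 ∧ J.Pairwise Measure.MutuallySingular}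
    fun c hc hchain => ⟨⋃₀ c, ⟨Set.sUnion_subset fun s hs => (hc hs).1,
      (Set.pairwise_sUnion hchain.directedOn).2 fun s hs => (hc hs).2⟩,
      fun s hs => Set.subset_sUnion_of_mem hs⟩
  refine ⟨J, hJ.prop.1, hJ.prop.2, fun κ hκ hκJ => ?_⟩
  have hmem : κ ∈ J := hJ.le_of_ge (y := insert κ J)
    ⟨Set.insert_subset hκ hJ.prop.1, Set.pairwise_insert.2
      ⟨hJ.prop.2, fun j hj _ => ⟨hκJ j hj, (hκJ j hj).symm⟩⟩⟩
    (Set.subset_insert _ _) (Set.mem_insert _ _)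
  exact (Measure.MutuallySingular.self_iff κ).1 (hκJ κ hmem)

theorem IsMaximalMutuallySingular.tsum_carrierMass {𝒞 J : Set (Measure Ω)}
    (hJ : IsMaximalMutuallySingular 𝒞 J) {κ : Measure Ω} [IsFiniteMeasure κ]
    (hκ : ∀ A, MeasurableSet A → κ.restrict A ∈ 𝒞) :
    ∑' j : J, carrierMass j.1 κ = κ Set.univ := by
  have hle := tsum_carrierMass_le hJ.pairwise κ
  refine le_antisymm hle ?_
  set I := Function.support fun j : J => carrierMass j.1 κ
  have hI : I.Countable := Summable.countable_support_ennreal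
    (hle.trans_lt (measure_lt_top κ _)).ne
  choose A hA hj hκA using fun j : J => exists_measurableSet_eq_carrierMass j.1 κ
  set U : Set Ω := ⋃ j ∈ I, A j with hU
  have hUm : MeasurableSet U := MeasurableSet.biUnion hI fun j _ => hA j
  have hκU : κ.restrict Uᶜ = 0 := by
    refine hJ.eq_zero _ (hκ _ hUm.compl) fun j hjJ => ?_
    by_cases h0 : carrierMass j κ = 0
    · exact (mutuallySingular_of_carrierMass_eq_zero h0).mono Measure.restrict_le_self le_rfl
    · refine ⟨U, hUm, by simp [Measure.restrict_apply hUm], ?_⟩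
      exact Filter.mem_of_superset (hj ⟨j, hjJ⟩)
        (Set.subset_biUnion_of_mem (u := A) (x := ⟨j, hjJ⟩) h0)
  have := hI.to_subtype
  calc κ Set.univ = κ U + κ.restrict Uᶜ Set.univ := by
        rw [Measure.restrict_apply_univ, measure_add_measure_compl hUm]
    _ = κ (⋃ j : I, A j) := by rw [hκU, hU, Set.biUnion_eq_iUnion]; simp
    _ ≤ ∑' j : I, κ (A j) := measure_iUnion_le _
    _ = ∑' j : I, carrierMass j.1.1 κ := tsum_congr fun j => hκA j.1
    _ = ∑' j : J, carrierMass j.1 κ :=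
        tsum_subtype_eq_of_support_subset (f := fun j : J => carrierMass j.1 κ) subset_rfl

end CarrierMass

section Functionals

variable {𝕜 Y X : Type*} [RCLike 𝕜] [MetricSpace Y] [NormedAddCommGroup X] [NormedSpace 𝕜 X]
  {S : Set Y}

theorem Lip.norm_sub_le_lipConst_mul (f : Lip 𝕜 Y X) (x y : Y) :
    ‖f x - f y‖ ≤ Lip.lipConst f * dist x y := by
  rcases eq_or_ne x y with rfl | h
  · simp
  · exact (div_le_iff₀ (dist_pos.2 h)).1
      (le_ciSup (Lip.bddAbove_quotients f) (⟨(x, y), h⟩ : {p : Y × Y // p.1 ≠ p.2}))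

theorem Lip.lipConst_le (f : Lip 𝕜 Y X) {c : ℝ} (hc : 0 ≤ c)
    (h : ∀ x y, ‖f x - f y‖ ≤ c * dist x y) : Lip.lipConst f ≤ c :=
  Real.iSup_le (fun p => (div_le_iff₀ (dist_pos.2 p.2)).2 (h _ _)) hc

/-- The functional `E` looks like an average of values at points of `S` at distance at most `ρ`
from `y`. -/
def IsEvaluationNear (y : Y) (ρ : ℝ) (E : Lip 𝕜 S X →ₗ[𝕜] X) : Prop :=
  ∀ (f : Lip 𝕜 S X) (s : S), ‖E f - f s‖ ≤ Lip.lipConst f * (ρ + dist y s)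

theorem IsEvaluationNear.mono {y : Y} {ρ ρ' : ℝ} {E : Lip 𝕜 S X →ₗ[𝕜] X}
    (hE : IsEvaluationNear y ρ E) (h : ρ ≤ ρ') : IsEvaluationNear y ρ' E := fun f s =>
  (hE f s).trans (mul_le_mul_of_nonneg_left (by gcongr) (Lip.lipConst_nonneg f))

theorem IsEvaluationNear.norm_sub_le {y y' : Y} {ρ ρ' : ℝ} {E E' : Lip 𝕜 S X →ₗ[𝕜] X}
    (hE : IsEvaluationNear y ρ E) (hE' : IsEvaluationNear y' ρ' E') (f : Lip 𝕜 S X) (s : S) :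
    ‖E f - E' f‖ ≤ Lip.lipConst f * (ρ + ρ' + dist y s + dist y' s) :=
  calc ‖E f - E' f‖ ≤ ‖E f - f s‖ + ‖f s - E' f‖ := norm_sub_le_norm_sub_add_norm_sub _ _ _
    _ ≤ Lip.lipConst f * (ρ + dist y s) + Lip.lipConst f * (ρ' + dist y' s) := by
        rw [norm_sub_rev (f s)]
        exact add_le_add (hE f s) (hE' f s)
    _ = Lip.lipConst f * (ρ + ρ' + dist y s + dist y' s) := by ring

theorem exists_isEvaluationNear_zero [CompleteSpace X] {y : Y} (hy : y ∈ closure S) :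
    ∃ E : Lip 𝕜 S X →ₗ[𝕜] X, IsEvaluationNear y 0 E := by
  let l : Filter S := (nhds y).comap (↑)
  have : l.NeBot := mem_closure_iff_comap_neBot.1 hy
  have hl : Cauchy l := cauchy_nhds.comap' le_rfl this
  have hlim (f : Lip 𝕜 S X) : ∃ z, Filter.Tendsto f l (nhds z) := by
    obtain ⟨K, hK⟩ := f.2
    exact cauchy_map_iff_exists_tendsto.1 (hl.map hK.uniformContinuous)
  choose e he using hlim
  refine ⟨⟨⟨e, fun f g => tendsto_nhds_unique (he (f + g)) ((he f).add (he g))⟩,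
    fun c f => tendsto_nhds_unique (he (c • f)) ((he f).const_smul c)⟩, fun f t => ?_⟩
  have hdist : Filter.Tendsto (fun s : S => Lip.lipConst f * dist (s : Y) t) l
      (nhds (Lip.lipConst f * dist y t)) :=
    (Filter.tendsto_comap.dist tendsto_const_nhds).const_mul _
  rw [zero_add]
  exact le_of_tendsto_of_tendsto' ((he f).sub_const (f t)).norm hdist
    fun s => Lip.norm_sub_le_lipConst_mul f s t

theorem extensionConst_le_of_norm_sub_le {Λ : ℝ} (hΛ : 0 ≤ Λ) (E : Y → Lip 𝕜 S X →ₗ[𝕜] X)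
    (hES : ∀ (f : Lip 𝕜 S X) (s : S), E s f = f s)
    (hE : ∀ (f : Lip 𝕜 S X) (y y' : Y), ‖E y f - E y' f‖ ≤ Λ * Lip.lipConst f * dist y y') :
    extensionConst 𝕜 X S ≤ ENNReal.ofReal Λ := by
  have hc (f : Lip 𝕜 S X) : 0 ≤ Λ * Lip.lipConst f := mul_nonneg hΛ (Lip.lipConst_nonneg f)
  let T₀ : Lip 𝕜 S X →ₗ[𝕜] Lip 𝕜 Y X :=
    { toFun := fun f => ⟨fun y => E y f, ⟨⟨_, hc f⟩, LipschitzWith.of_dist_le_mul fun y y' => by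
        rw [dist_eq_norm]; exact hE f y y'⟩⟩
      map_add' := fun f g => Subtype.ext (funext fun y => map_add (E y) f g)
      map_smul' := fun c f => Subtype.ext (funext fun y => map_smul (E y) c f) }
  have hT₀ (f : Lip 𝕜 S X) : ‖T₀ f‖ ≤ Λ * ‖f‖ := Lip.lipConst_le (T₀ f) (hc f) (hE f)
  have hmem : T₀.mkContinuous Λ hT₀ ∈ lipExtensions 𝕜 X S := hES
  exact (iInf₂_le _ hmem).trans (ENNReal.ofReal_le_ofReal (T₀.mkContinuous_norm_le hΛ hT₀))

theorem IsEvaluationNear.norm_sub_le_of_local (hS : S.Nonempty) {Λ : ℝ} (hΛ : 0 ≤ Λ)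
    {E : Y → Lip 𝕜 S X →ₗ[𝕜] X} (hE : ∀ y, IsEvaluationNear y (4 * infDist y S) (E y))
    {f : Lip 𝕜 S X} {y y' : Y}
    (hlocal : dist y y' < infDist y S / 4 → ‖E y f - E y' f‖ ≤ Λ * Lip.lipConst f * dist y y')
    (hyy' : infDist y' S ≤ infDist y S) :
    ‖E y f - E y' f‖ ≤ (43 + Λ) * Lip.lipConst f * dist y y' := by
  have hL := Lip.lipConst_nonneg f
  rcases lt_or_ge (dist y y') (infDist y S / 4) with hnear | hfar
  · exact (hlocal hnear).trans (by gcongr; linarith)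
  rcases eq_or_ne y y' with rfl | hne
  · simp
  obtain ⟨s, hs, hys⟩ : ∃ s ∈ S, dist y s < infDist y S + dist y y' :=
    (infDist_lt_iff hS).1 (lt_add_of_pos_right _ (dist_pos.2 hne))
  calc ‖E y f - E y' f‖
      ≤ Lip.lipConst f * (4 * infDist y S + 4 * infDist y' S + dist y s + dist y' s) :=
        (hE y).norm_sub_le (hE y') f ⟨s, hs⟩
    _ ≤ Lip.lipConst f * ((43 + Λ) * dist y y') := by
        gcongr
        linarith [dist_triangle_left y' s y, mul_nonneg hΛ (dist_nonneg (x := y) (y := y'))]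
    _ = (43 + Λ) * Lip.lipConst f * dist y y' := by ring

theorem extensionConst_le_of_isEvaluationNear (hS : S.Nonempty) {Λ : ℝ} (hΛ : 0 ≤ Λ)
    (E : Y → Lip 𝕜 S X →ₗ[𝕜] X) (hE : ∀ y, IsEvaluationNear y (4 * infDist y S) (E y))
    (hlocal : ∀ (f : Lip 𝕜 S X) (y y' : Y), dist y y' < infDist y S / 4 →
      ‖E y f - E y' f‖ ≤ Λ * Lip.lipConst f * dist y y') :
    extensionConst 𝕜 X S ≤ ENNReal.ofReal (43 + Λ) := by
  refine extensionConst_le_of_norm_sub_le (by positivity) E (fun f s => ?_) fun f y y' => ?_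
  · have h := hE s f s
    rwa [infDist_zero_of_mem s.2, dist_self, mul_zero, add_zero, mul_zero, norm_le_zero_iff,
      sub_eq_zero] at h
  · rcases le_total (infDist y' S) (infDist y S) with h | h
    · exact IsEvaluationNear.norm_sub_le_of_local hS hΛ hE (hlocal f y y') h
    · rw [norm_sub_rev, dist_comm]
      exact IsEvaluationNear.norm_sub_le_of_local hS hΛ hE (hlocal f y' y) h

end Functionals

section Weights

variable {𝕜 Y X ι : Type*} [RCLike 𝕜] [MetricSpace Y] [NormedAddCommGroup X] [NormedSpace 𝕜 X]
  {S : Set Y} {s : ι → S} {y : Y} {ρ : ℝ} {a a' : ι → ℝ}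

/-- The numbers `a i` are the weights of a random point of `S`, namely `s i` with probability `a i`,
which lies at distance at most `ρ` from `y`. -/
structure IsWeightNear (s : ι → S) (y : Y) (ρ : ℝ) (a : ι → ℝ) : Prop where
  nonneg : ∀ i, 0 ≤ a i
  hasSum : HasSum a 1
  dist_le : ∀ i, a i ≠ 0 → dist y (s i) ≤ ρ

namespace IsWeightNear

theorem norm_sub_le (ha : IsWeightNear s y ρ a) (f : Lip 𝕜 S X) (t : S) {i : ι} (hi : a i ≠ 0) :
    ‖f (s i) - f t‖ ≤ Lip.lipConst f * (ρ + dist y t) := by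
  refine (Lip.norm_sub_le_lipConst_mul f _ _).trans
    (mul_le_mul_of_nonneg_left ?_ (Lip.lipConst_nonneg f))
  exact (dist_triangle_left (s i : Y) t y).trans (by gcongr; exact ha.dist_le i hi)

theorem norm_smul_sub_le (ha : IsWeightNear s y ρ a) (f : Lip 𝕜 S X) (t : S) (i : ι) :
    ‖(a i : 𝕜) • (f (s i) - f t)‖ ≤ a i * (Lip.lipConst f * (ρ + dist y t)) := by
  rw [norm_smul, RCLike.norm_ofReal, abs_of_nonneg (ha.nonneg i)]
  rcases eq_or_ne (a i) 0 with hi | hi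
  · simp [hi]
  · exact mul_le_mul_of_nonneg_left (ha.norm_sub_le f t hi) (ha.nonneg i)

theorem hasSum_smul_const (ha : IsWeightNear s y ρ a) (x : X) :
    HasSum (fun i => (a i : 𝕜) • x) x := by
  simpa using ((RCLike.hasSum_ofReal (𝕜 := 𝕜)).2 ha.hasSum).smul_const x

variable [CompleteSpace X]

theorem summable_smul (ha : IsWeightNear s y ρ a) (f : Lip 𝕜 S X) :
    Summable fun i => (a i : 𝕜) • f (s i) := by
  have : Nonempty ι := not_isEmpty_iff.1 fun _ => one_ne_zero (ha.hasSum.unique hasSum_empty)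
  obtain ⟨i₀⟩ := this
  have hsub : Summable fun i => (a i : 𝕜) • (f (s i) - f (s i₀)) :=
    .of_norm_bounded (ha.hasSum.summable.mul_right _) (ha.norm_smul_sub_le f (s i₀))
  refine (hsub.add (ha.hasSum_smul_const (𝕜 := 𝕜) (f (s i₀))).summable).congr fun i => ?_
  rw [smul_sub, sub_add_cancel]

variable (𝕜 X) in
/-- The expected value of `f` at the random point of `S` with the weights `a`. -/
def average (ha : IsWeightNear s y ρ a) : Lip 𝕜 S X →ₗ[𝕜] X where
  toFun f := ∑' i, (a i : 𝕜) • f (s i)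
  map_add' f g := by
    rw [← (ha.summable_smul f).tsum_add (ha.summable_smul g)]
    exact tsum_congr fun i => smul_add _ _ _
  map_smul' c f := by
    rw [RingHom.id_apply, ← (ha.summable_smul f).tsum_const_smul]
    exact tsum_congr fun i => smul_comm _ _ _

theorem hasSum_average_sub (ha : IsWeightNear s y ρ a) (f : Lip 𝕜 S X) (t : S) :
    HasSum (fun i => (a i : 𝕜) • (f (s i) - f t)) (ha.average 𝕜 X f - f t) := by
  simp only [smul_sub]
  exact (ha.summable_smul f).hasSum.sub (ha.hasSum_smul_const (f t))

theorem isEvaluationNear_average (ha : IsWeightNear s y ρ a) :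
    IsEvaluationNear y ρ (ha.average 𝕜 X) := fun f t => by
  rw [← (ha.hasSum_average_sub f t).tsum_eq]
  simpa using tsum_of_norm_bounded (ha.hasSum.mul_right _) (ha.norm_smul_sub_le f t)

theorem norm_average_sub_average_le {y' : Y} {ρ' r : ℝ} (ha : IsWeightNear s y ρ a)
    (ha' : IsWeightNear s y' ρ' a') (f : Lip 𝕜 S X) (t : S) (hr : ρ + dist y t ≤ r)
    (hr' : ρ' + dist y' t ≤ r) :
    ‖ha.average 𝕜 X f - ha'.average 𝕜 X f‖ ≤ (∑' i, |a i - a' i|) * (Lip.lipConst f * r) := by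
  have hL := Lip.lipConst_nonneg f
  have hdiff : HasSum (fun i => ((a i - a' i : ℝ) : 𝕜) • (f (s i) - f t))
      (ha.average 𝕜 X f - ha'.average 𝕜 X f) := by
    simpa only [← sub_smul, RCLike.ofReal_sub, sub_sub_sub_cancel_right]
      using (ha.hasSum_average_sub f t).sub (ha'.hasSum_average_sub f t)
  rw [← hdiff.tsum_eq]
  have hsummable : Summable fun i => |a i - a' i| :=
    (ha.hasSum.summable.sub ha'.hasSum.summable).abs
  refine tsum_of_norm_bounded (hsummable.hasSum.mul_right _) fun i => ?_
  rw [norm_smul, RCLike.norm_ofReal]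
  rcases eq_or_ne (a i) 0 with hi | hi
  · rcases eq_or_ne (a' i) 0 with hi' | hi'
    · simp [hi, hi']
    · exact mul_le_mul_of_nonneg_left ((ha'.norm_sub_le f t hi').trans (by gcongr)) (abs_nonneg _)
  · exact mul_le_mul_of_nonneg_left ((ha.norm_sub_le f t hi).trans (by gcongr)) (abs_nonneg _)

end IsWeightNear

theorem extensionConst_le_of_weights [CompleteSpace X] (hS : S.Nonempty) (s : ι → S) (a : Y → ι → ℝ)
    (ha : ∀ y ∉ closure S, IsWeightNear s y (4 * infDist y S) (a y)) {Λ : ℝ} (hΛ : 0 ≤ Λ)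
    (hdiff : ∀ y ∉ closure S, ∀ y' ∉ closure S, dist y y' < infDist y S / 4 →
      ∑' i, |a y i - a y' i| ≤ Λ * dist y y' / infDist y S) :
    extensionConst 𝕜 X S ≤ ENNReal.ofReal (43 + 8 * Λ) := by
  classical
  choose E₀ hE₀ using fun (y : Y) (hy : y ∈ closure S) =>
    exists_isEvaluationNear_zero (𝕜 := 𝕜) (X := X) hy
  let E (y : Y) : Lip 𝕜 S X →ₗ[𝕜] X :=
    if hy : y ∈ closure S then E₀ y hy else (ha y hy).average 𝕜 X
  have hE (y : Y) : IsEvaluationNear y (4 * infDist y S) (E y) := by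
    by_cases hy : y ∈ closure S
    · simpa only [E, dif_pos hy] using (hE₀ y hy).mono (mul_nonneg zero_le_four infDist_nonneg)
    · simpa only [E, dif_neg hy] using (ha y hy).isEvaluationNear_average
  refine extensionConst_le_of_isEvaluationNear hS (by positivity) E hE fun f y y' hyy' => ?_
  have hpos : 0 < infDist y S := by linarith [dist_nonneg (x := y) (y := y')]
  have hle : infDist y S ≤ infDist y' S + dist y y' := infDist_le_infDist_add_dist
  have hle' : infDist y' S ≤ infDist y S + dist y' y := infDist_le_infDist_add_dist
  have hy : y ∉ closure S := (infDist_pos_iff_notMem_closure hS).2 hpos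
  have hy' : y' ∉ closure S := (infDist_pos_iff_notMem_closure hS).2 (by linarith)
  obtain ⟨t, ht, hyt⟩ : ∃ t ∈ S, dist y t < 2 * infDist y S :=
    (infDist_lt_iff hS).1 (by linarith)
  have hy't := dist_triangle_left y' t y
  rw [dist_comm y'] at hle'
  have hL := Lip.lipConst_nonneg f
  simp only [E, dif_neg hy, dif_neg hy']
  calc ‖(ha y hy).average 𝕜 X f - (ha y' hy').average 𝕜 X f‖
      ≤ (∑' i, |a y i - a y' i|) * (Lip.lipConst f * (8 * infDist y S)) :=
        (ha y hy).norm_average_sub_average_le (ha y' hy') f ⟨t, ht⟩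
          (by simp only; linarith) (by simp only; linarith)
    _ ≤ (Λ * dist y y' / infDist y S) * (Lip.lipConst f * (8 * infDist y S)) :=
        mul_le_mul_of_nonneg_right (hdiff y hy y' hy' hyy') (by positivity)
    _ = 8 * Λ * Lip.lipConst f * dist y y' := by field_simp

end Weights

section Kernels

variable {Ω : Type*} [MeasurableSpace Ω]

theorem exists_of_carrierMass_ne_zero {j κ : Measure Ω} (h : carrierMass j κ ≠ 0) {P Q : Ω → Prop}
    (hP : ∀ᵐ x ∂j, P x) (hQ : ∀ᵐ x ∂κ, Q x) : ∃ x, P x ∧ Q x := by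
  contrapose! h
  exact le_antisymm ((carrierMass_le hP κ).trans
    (measure_mono_null (fun x hx => h x hx) (ae_iff.1 hQ)).le) zero_le

theorem IsMaximalMutuallySingular.hasSum_toReal_carrierMass {𝒞 J : Set (Measure Ω)}
    (hJ : IsMaximalMutuallySingular 𝒞 J) {κ : Measure Ω} [IsProbabilityMeasure κ]
    (hκ : ∀ A, MeasurableSet A → κ.restrict A ∈ 𝒞) :
    HasSum (fun j : J => (carrierMass j.1 κ).toReal) 1 := by
  have htsum : ∑' j : J, carrierMass j.1 κ = 1 := (hJ.tsum_carrierMass hκ).trans measure_univ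
  have hne : ∑' j : J, carrierMass j.1 κ ≠ ⊤ := htsum ▸ ENNReal.one_ne_top
  simpa only [← ENNReal.tsum_toReal_eq fun j => ENNReal.ne_top_of_tsum_ne_top hne j, htsum,
    ENNReal.toReal_one] using (ENNReal.summable_toReal hne).hasSum

theorem tsum_abs_sub_le_of_le_of_le {ι : Type*} {a a' g : ι → ℝ} {A A' : ℝ} (ha : HasSum a A)
    (ha' : HasSum a' A') (hg : Summable g) (hag : ∀ i, a i ≤ g i) (hag' : ∀ i, a' i ≤ g i) :
    ∑' i, |a i - a' i| ≤ (∑' i, g i - A) + (∑' i, g i - A') := by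
  have hsum := (hg.hasSum.sub ha).add (hg.hasSum.sub ha')
  refine (ha.summable.sub ha'.summable).abs.tsum_le_tsum (fun i => ?_) hsum.summable |>.trans
    hsum.tsum_eq.le
  rw [abs_le]
  constructor <;> linarith [hag i, hag' i]

theorem tsum_abs_sub_toReal_carrierMass_le {J : Set (Measure Ω)}
    (hJ : J.Pairwise Measure.MutuallySingular) {κ κ' G : Measure Ω} [IsFiniteMeasure G]
    (hκ : HasSum (fun j : J => (carrierMass j.1 κ).toReal) 1)
    (hκ' : HasSum (fun j : J => (carrierMass j.1 κ').toReal) 1) (hκG : κ ≤ G) (hκG' : κ' ≤ G) :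
    ∑' j : J, |(carrierMass j.1 κ).toReal - (carrierMass j.1 κ').toReal| ≤
      2 * ((G Set.univ).toReal - 1) := by
  have hle := tsum_carrierMass_le hJ G
  have hne := ne_top_of_le_ne_top (measure_ne_top G _) hle
  have hfin (j : J) : carrierMass j.1 G ≠ ⊤ := ENNReal.ne_top_of_tsum_ne_top hne j
  have hmass : ∑' j : J, (carrierMass j.1 G).toReal ≤ (G Set.univ).toReal := by
    rw [← ENNReal.tsum_toReal_eq hfin]
    exact ENNReal.toReal_mono (measure_ne_top G _) hle
  linarith [tsum_abs_sub_le_of_le_of_le hκ hκ' (ENNReal.summable_toReal hne)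
    (fun j => ENNReal.toReal_mono (hfin j) (carrierMass_mono j.1 hκG))
    (fun j => ENNReal.toReal_mono (hfin j) (carrierMass_mono j.1 hκG'))]

/-- The measure `κ` is concentrated at points whose location `loc` in `Y` is much closer to `y` than
`S` is. -/
def IsConcentratedNear {Y : Type*} [MetricSpace Y] (S : Set Y) (loc : Ω → Y) (y : Y)
    (κ : Measure Ω) : Prop :=
  ∀ᵐ x ∂κ, dist y (loc x) < infDist y S / 4

theorem exists_nearby_point_of_isConcentratedNear {Y : Type*} [MetricSpace Y] {S : Set Y}
    (hS : S.Nonempty) {loc : Ω → Y} {j : Measure Ω} {z : Y} (hz : z ∉ closure S)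
    (hj : IsConcentratedNear S loc z j) :
    ∃ s : S, ∀ (y : Y) (κ : Measure Ω), IsConcentratedNear S loc y κ → carrierMass j κ ≠ 0 →
      dist y s ≤ 4 * infDist y S := by
  obtain ⟨s, hs, hzs⟩ : ∃ s ∈ S, dist z s < 2 * infDist z S :=
    (infDist_lt_iff hS).1 (by linarith [(infDist_pos_iff_notMem_closure hS).1 hz])
  refine ⟨⟨s, hs⟩, fun y κ hκ hne => ?_⟩
  obtain ⟨x, hzx, hyx⟩ := exists_of_carrierMass_ne_zero hne hj hκ
  have hzy : infDist z S ≤ infDist y S + dist z y := infDist_le_infDist_add_dist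
  rw [dist_comm] at hzy
  linarith [dist_triangle_right y z (loc x), dist_triangle y z s]

theorem extensionConst_le_of_kernels {𝕜 Y X : Type*} [RCLike 𝕜] [MetricSpace Y]
    [NormedAddCommGroup X] [NormedSpace 𝕜 X] [CompleteSpace X] {S : Set Y} (hS : S.Nonempty)
    (loc : Ω → Y) (k : Y → Measure Ω) (hk : ∀ y ∉ closure S, IsProbabilityMeasure (k y))
    (hknear : ∀ y ∉ closure S, IsConcentratedNear S loc y (k y)) {Λ : ℝ} (hΛ : 0 ≤ Λ)
    (hkdiff : ∀ y ∉ closure S, ∀ y' ∉ closure S, dist y y' < infDist y S / 4 →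
      ∃ G : Measure Ω, k y ≤ G ∧ k y' ≤ G ∧
        G Set.univ ≤ ENNReal.ofReal (1 + Λ * dist y y' / infDist y S)) :
    extensionConst 𝕜 X S ≤ ENNReal.ofReal (43 + 16 * Λ) := by
  let 𝒞 : Set (Measure Ω) := {κ | ∃ y ∉ closure S, IsConcentratedNear S loc y κ}
  obtain ⟨J, hJ⟩ := exists_isMaximalMutuallySingular 𝒞
  choose s hs using fun j : J =>
    (hJ.subset j.2).elim fun z hz => exists_nearby_point_of_isConcentratedNear hS hz.1 hz.2
  let a (y : Y) (j : J) : ℝ := (carrierMass j.1 (k y)).toReal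
  have hsum (y : Y) (hy : y ∉ closure S) : HasSum (a y) 1 :=
    have := hk y hy
    hJ.hasSum_toReal_carrierMass fun A _ => ⟨y, hy, ae_restrict_of_ae (hknear y hy)⟩
  have ha (y : Y) (hy : y ∉ closure S) : IsWeightNear s y (4 * infDist y S) (a y) :=
    ⟨fun _ => ENNReal.toReal_nonneg, hsum y hy, fun j hj =>
      hs j y (k y) (hknear y hy) fun h => hj (by simp only [a, h, ENNReal.toReal_zero])⟩
  rw [show 16 * Λ = 8 * (2 * Λ) by ring]
  refine extensionConst_le_of_weights hS s a ha (by positivity) fun y hy y' hy' hyy' => ?_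
  obtain ⟨G, hG, hG', hGuniv⟩ := hkdiff y hy y' hy' hyy'
  have : IsFiniteMeasure G := ⟨hGuniv.trans_lt ENNReal.ofReal_lt_top⟩
  have hnonneg : 0 ≤ Λ * dist y y' / infDist y S :=
    div_nonneg (mul_nonneg hΛ dist_nonneg) infDist_nonneg
  calc ∑' j, |a y j - a y' j|
      ≤ 2 * ((G Set.univ).toReal - 1) :=
        tsum_abs_sub_toReal_carrierMass_le hJ.pairwise (hsum y hy) (hsum y' hy') hG hG'
    _ ≤ 2 * (1 + Λ * dist y y' / infDist y S - 1) := by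
        gcongr
        exact ENNReal.toReal_le_of_le_ofReal (by positivity) hGuniv
    _ = 2 * Λ * dist y y' / infDist y S := by ring

end Kernels

section Decay

/-- A weight that is constant up to `1`, decays exponentially with rate `b` and vanishes from `3`
on. The subtracted constant makes it continuous. -/
def decay (b t : ℝ) : ℝ :=
  Real.exp (-(b * max 1 (min t 3))) - Real.exp (-(b * 3))

theorem decay_antitone {b : ℝ} (hb : 0 ≤ b) : Antitone (decay b) := by
  intro s t hst
  unfold decay
  gcongr

theorem continuous_decay (b : ℝ) : Continuous (decay b) := by
  unfold decay
  fun_prop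

theorem decay_of_three_le (b : ℝ) {t : ℝ} (ht : 3 ≤ t) : decay b t = 0 := by
  rw [decay, min_eq_right ht, max_eq_right (by norm_num), sub_self]

theorem decay_of_le_one (b : ℝ) {t : ℝ} (ht : t ≤ 1) :
    decay b t = Real.exp (-(b * 3)) * (Real.exp (2 * b) - 1) := by
  rw [decay, min_eq_left (by linarith), max_eq_left ht, mul_sub, ← Real.exp_add]
  ring_nf

theorem decay_nonneg {b : ℝ} (hb : 0 ≤ b) (t : ℝ) : 0 ≤ decay b t := by
  rw [← decay_of_three_le b (le_max_right t 3)]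
  exact decay_antitone hb (le_max_left t 3)

theorem decay_le_one {b : ℝ} (hb : 0 ≤ b) (t : ℝ) : decay b t ≤ 1 := by
  have h : Real.exp (-(b * max 1 (min t 3))) ≤ 1 := by
    rw [Real.exp_le_one_iff, neg_nonpos]
    positivity
  unfold decay
  linarith [Real.exp_pos (-(b * 3))]

theorem decay_sub_le {b h : ℝ} (hb : 0 ≤ b) (hh : 0 ≤ h) (t : ℝ) :
    decay b (t - h) ≤
      decay b t + (Real.exp (b * h) - 1) * (decay b t + Real.exp (-(b * 3))) := by
  have hclamp : max 1 (min t 3) ≤ h + max 1 (min (t - h) 3) := by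
    rcases le_total t 3 with ht | ht
    · rw [min_eq_left ht, min_eq_left (by linarith), ← max_add_add_left]
      exact max_le_max (by linarith) (by linarith)
    · rw [min_eq_right ht, max_eq_right (by norm_num), ← max_add_add_left, ← min_add_add_left]
      exact le_max_of_le_right (le_min (by linarith) (by linarith))
  have hexp : Real.exp (-(b * max 1 (min (t - h) 3))) ≤
      Real.exp (b * h) * Real.exp (-(b * max 1 (min t 3))) := by
    rw [← Real.exp_add, Real.exp_le_exp]
    linarith [mul_le_mul_of_nonneg_left hclamp hb]
  unfold decay
  linarith

end Decay

section Sublevels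

variable {Ω Ω' : Type*} [MeasurableSpace Ω] [MeasurableSpace Ω']

theorem iUnion_Iio_rat_eq {U : Set ℝ} (hU : IsOpen U) (hUl : IsLowerSet U) :
    ⋃ q : {q : ℚ // (q : ℝ) ∈ U}, Set.Iio (q : ℝ) = U := by
  refine (Set.iUnion_subset fun q x hx => hUl (le_of_lt hx) q.2).antisymm fun x hx => ?_
  obtain ⟨y, hxy, hyU⟩ := exists_Ico_subset_of_mem_nhds (hU.mem_nhds hx) (exists_gt x)
  obtain ⟨q, hxq, hqy⟩ := exists_rat_btwn hxy
  exact Set.mem_iUnion.2 ⟨⟨q, hyU ⟨hxq.le, hqy⟩⟩, hxq⟩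

theorem measure_preimage_le_of_sublevel_le {H : Measure Ω'} {ν : Measure Ω} {σ' : Ω' → ℝ}
    {σ : Ω → ℝ} {c : ℝ≥0∞} (h : ∀ s, H {x | σ' x < s} ≤ c * ν {x | σ x < s}) {U : Set ℝ}
    (hU : IsOpen U) (hUl : IsLowerSet U) : H (σ' ⁻¹' U) ≤ c * ν (σ ⁻¹' U) := by
  have hdir : Directed (· ⊆ ·)
      fun q : {q : ℚ // (q : ℝ) ∈ U} => σ' ⁻¹' Set.Iio ((q : ℚ) : ℝ) := by
    refine Monotone.directed_le fun q r hqr => Set.preimage_mono (Set.Iio_subset_Iio ?_)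
    exact_mod_cast hqr
  calc H (σ' ⁻¹' U) = ⨆ q : {q : ℚ // (q : ℝ) ∈ U}, H {x | σ' x < q} := by
        conv_lhs => rw [← iUnion_Iio_rat_eq hU hUl, Set.preimage_iUnion]
        exact hdir.measure_iUnion
    _ ≤ c * ν (σ ⁻¹' U) := iSup_le fun q => (h q).trans
        (by gcongr; exact fun x (hx : σ x < q) => hUl hx.le q.2)

theorem lintegral_comp_antitone_le {H ν : Measure Ω} {σ : Ω → ℝ} (hσ : Measurable σ) {c : ℝ≥0∞}
    (hc : c ≠ ⊤) (h : ∀ s, H {x | σ x < s} ≤ c * ν {x | σ x < s}) {g : ℝ → ℝ} (hg : Antitone g)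
    (hgc : Continuous g) (hg0 : ∀ t, 0 ≤ g t) :
    ∫⁻ x, ENNReal.ofReal (g (σ x)) ∂H ≤ c * ∫⁻ x, ENNReal.ofReal (g (σ x)) ∂ν := by
  have hm : Measurable fun x => g (σ x) := hgc.measurable.comp hσ
  rw [lintegral_eq_lintegral_meas_lt H (.of_forall fun x => hg0 _) hm.aemeasurable,
    lintegral_eq_lintegral_meas_lt ν (.of_forall fun x => hg0 _) hm.aemeasurable,
    ← lintegral_const_mul' c _ hc]
  exact lintegral_mono fun t => measure_preimage_le_of_sublevel_le (U := {r | t < g r}) h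
    (isOpen_lt continuous_const hgc) fun r r' hr (ht : t < g r) => ht.trans_le (hg hr)

end Sublevels

section DecayKernel

variable {Ω : Type*} [MeasurableSpace Ω] {b t ε : ℝ} {ν ν' H : Measure Ω} {σ σ' : Ω → ℝ}

/-- The total mass of the measure `ν` with density `decay b ∘ σ`. -/
def decayMass (b : ℝ) (ν : Measure Ω) (σ : Ω → ℝ) : ℝ≥0∞ :=
  ∫⁻ x, ENNReal.ofReal (decay b (σ x)) ∂ν

/-- The measure `ν` with density `decay b ∘ σ`, normalised to a probability measure. -/
def decayKernel (b : ℝ) (ν : Measure Ω) (σ : Ω → ℝ) : Measure Ω :=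
  (decayMass b ν σ)⁻¹ • ν.withDensity fun x => ENNReal.ofReal (decay b (σ x))

/-- The sublevel sets `{σ < 1}` and `{σ < 4}` have finite and positive measures that are comparable
up to the factor by which `decay b` can compensate. -/
structure HasGrowth (b : ℝ) (ν : Measure Ω) (σ : Ω → ℝ) : Prop where
  measurable : Measurable σ
  pos : 0 < ν {x | σ x < 1}
  finite : ν {x | σ x < 4} < ⊤
  growth : ν {x | σ x < 4} ≤ ENNReal.ofReal (Real.exp (2 * b) - 1) * ν {x | σ x < 1}

namespace HasGrowth

theorem measurable_decay (h : HasGrowth b ν σ) :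
    Measurable fun x => ENNReal.ofReal (decay b (σ x)) :=
  ((continuous_decay b).measurable.comp h.measurable).ennreal_ofReal

theorem measurableSet_sublevel (h : HasGrowth b ν σ) (s : ℝ) : MeasurableSet {x | σ x < s} :=
  measurableSet_lt h.measurable measurable_const

theorem mul_sublevel_one_le (h : HasGrowth b ν σ) :
    ENNReal.ofReal (Real.exp (-(b * 3)) * (Real.exp (2 * b) - 1)) * ν {x | σ x < 1} ≤
      decayMass b ν σ := by
  rw [← setLIntegral_const]
  refine (setLIntegral_mono' (h.measurableSet_sublevel 1) fun x hx => ?_).trans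
    (setLIntegral_le_lintegral _ _)
  rw [decay_of_le_one b (le_of_lt hx)]

theorem mul_sublevel_four_le (h : HasGrowth b ν σ) :
    ENNReal.ofReal (Real.exp (-(b * 3))) * ν {x | σ x < 4} ≤ decayMass b ν σ :=
  calc ENNReal.ofReal (Real.exp (-(b * 3))) * ν {x | σ x < 4}
      ≤ ENNReal.ofReal (Real.exp (-(b * 3))) *
          (ENNReal.ofReal (Real.exp (2 * b) - 1) * ν {x | σ x < 1}) := by
        gcongr
        exact h.growth
    _ ≤ decayMass b ν σ := by
        rw [← mul_assoc, ← ENNReal.ofReal_mul (Real.exp_pos _).le]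
        exact h.mul_sublevel_one_le

theorem decayMass_ne_zero (hb : 0 < b) (h : HasGrowth b ν σ) : decayMass b ν σ ≠ 0 := by
  have hexp : 1 < Real.exp (2 * b) := Real.one_lt_exp_iff.2 (by positivity)
  refine ((ENNReal.mul_pos ?_ h.pos.ne').trans_le h.mul_sublevel_one_le).ne'
  exact (ENNReal.ofReal_pos.2 (mul_pos (Real.exp_pos _) (sub_pos.2 hexp))).ne'

theorem decayMass_ne_top (hb : 0 ≤ b) (h : HasGrowth b ν σ) : decayMass b ν σ ≠ ⊤ := by
  refine (lt_of_le_of_lt ?_ h.finite).ne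
  rw [decayMass, ← lintegral_indicator_one (h.measurableSet_sublevel 4)]
  refine lintegral_mono fun x => ?_
  by_cases hx : σ x < 4
  · rw [Set.indicator_of_mem (show x ∈ {x | σ x < 4} from hx)]
    exact ENNReal.ofReal_le_one.2 (decay_le_one hb _)
  · rw [decay_of_three_le b (by linarith), ENNReal.ofReal_zero]
    exact zero_le

theorem isProbabilityMeasure_decayKernel (hb : 0 < b) (h : HasGrowth b ν σ) :
    IsProbabilityMeasure (decayKernel b ν σ) := by
  refine ⟨?_⟩
  rw [decayKernel, Measure.smul_apply, withDensity_apply _ MeasurableSet.univ,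
    Measure.restrict_univ]
  exact ENNReal.inv_mul_cancel (h.decayMass_ne_zero hb) (h.decayMass_ne_top hb.le)

theorem ae_decayKernel_lt (h : HasGrowth b ν σ) : ∀ᵐ x ∂decayKernel b ν σ, σ x < 3 := by
  refine Measure.ae_smul_measure ((ae_withDensity_iff h.measurable_decay).2 ?_) _
  refine .of_forall fun x hx => ?_
  contrapose! hx
  rw [decay_of_three_le b hx, ENNReal.ofReal_zero]

theorem lintegral_decay_sub_le (hb : 0 ≤ b) (ht : 0 ≤ t) (ht1 : t ≤ 1) (h : HasGrowth b ν σ) :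
    ∫⁻ x, ENNReal.ofReal (decay b (σ x - t)) ∂ν ≤
      ENNReal.ofReal (1 + 2 * (Real.exp (b * t) - 1)) * decayMass b ν σ := by
  have he : 0 ≤ Real.exp (b * t) - 1 := sub_nonneg.2 (Real.one_le_exp (mul_nonneg hb ht))
  set w : Ω → ℝ≥0∞ := fun x => ENNReal.ofReal (decay b (σ x))
  set tail : Ω → ℝ≥0∞ := {x | σ x < 4}.indicator fun _ => ENNReal.ofReal (Real.exp (-(b * 3)))
  have hw : Measurable w := h.measurable_decay
  have htail : ∫⁻ x, tail x ∂ν ≤ decayMass b ν σ := by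
    rw [lintegral_indicator_const (h.measurableSet_sublevel 4)]
    exact h.mul_sublevel_four_le
  have hpoint (x : Ω) : ENNReal.ofReal (decay b (σ x - t)) ≤
      w x + ENNReal.ofReal (Real.exp (b * t) - 1) * (w x + tail x) := by
    by_cases hx : σ x < 4
    · have hd := decay_nonneg hb (σ x)
      rw [show tail x = ENNReal.ofReal (Real.exp (-(b * 3))) from
          Set.indicator_of_mem (s := {x | σ x < 4}) hx _,
        ← ENNReal.ofReal_add hd (by positivity), ← ENNReal.ofReal_mul he,
        ← ENNReal.ofReal_add hd (by positivity)]
      exact ENNReal.ofReal_le_ofReal (decay_sub_le hb ht _)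
    · rw [decay_of_three_le b (by linarith), ENNReal.ofReal_zero]
      exact zero_le
  calc ∫⁻ x, ENNReal.ofReal (decay b (σ x - t)) ∂ν
      ≤ ∫⁻ x, w x + ENNReal.ofReal (Real.exp (b * t) - 1) * (w x + tail x) ∂ν :=
        lintegral_mono hpoint
    _ = decayMass b ν σ +
          ENNReal.ofReal (Real.exp (b * t) - 1) * (decayMass b ν σ + ∫⁻ x, tail x ∂ν) := by
        rw [lintegral_add_left hw, lintegral_const_mul' _ _ ENNReal.ofReal_ne_top,
          lintegral_add_left hw, decayMass]
    _ ≤ decayMass b ν σ +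
          ENNReal.ofReal (Real.exp (b * t) - 1) * (decayMass b ν σ + decayMass b ν σ) := by
        gcongr
    _ = ENNReal.ofReal (1 + 2 * (Real.exp (b * t) - 1)) * decayMass b ν σ := by
        rw [ENNReal.ofReal_add zero_le_one (by positivity), ENNReal.ofReal_mul zero_le_two,
          ENNReal.ofReal_one, ENNReal.ofReal_ofNat]
        ring

theorem lintegral_max_decay_le (hb : 0 ≤ b) (ht : 0 ≤ t) (ht1 : t ≤ 1) (hbt : b * t ≤ 1)
    (hε : 0 ≤ ε) (hε1 : ε ≤ 1) (h : HasGrowth b ν σ)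
    (hH : ∀ s, H {x | σ x < s} ≤ ENNReal.ofReal (1 + ε) * ν {x | σ x < s})
    (hσ : ∀ x, σ' x < 3 → σ x ≤ σ' x + t) :
    ∫⁻ x, max (ENNReal.ofReal (decay b (σ x))) (ENNReal.ofReal (decay b (σ' x))) ∂H ≤
      ENNReal.ofReal (1 + (ε + 8 * (b * t))) * decayMass b ν σ := by
  have hbt0 : 0 ≤ b * t := mul_nonneg hb ht
  have hexp : Real.exp (b * t) - 1 ≤ 2 * (b * t) := by
    have := Real.abs_exp_sub_one_le (x := b * t) (by rwa [abs_of_nonneg hbt0])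
    rw [abs_of_nonneg hbt0] at this
    exact (le_abs_self _).trans this
  calc ∫⁻ x, max (ENNReal.ofReal (decay b (σ x))) (ENNReal.ofReal (decay b (σ' x))) ∂H
      ≤ ∫⁻ x, ENNReal.ofReal (decay b (σ x - t)) ∂H := by
        refine lintegral_mono fun x => max_le ?_ ?_
        · exact ENNReal.ofReal_le_ofReal (decay_antitone hb (by linarith))
        · by_cases hx : σ' x < 3
          · exact ENNReal.ofReal_le_ofReal (decay_antitone hb (by linarith [hσ x hx]))
          · rw [decay_of_three_le b (not_lt.1 hx), ENNReal.ofReal_zero]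
            exact zero_le
    _ ≤ ENNReal.ofReal (1 + ε) * ∫⁻ x, ENNReal.ofReal (decay b (σ x - t)) ∂ν :=
        lintegral_comp_antitone_le (g := fun s => decay b (s - t)) h.measurable
          ENNReal.ofReal_ne_top hH (fun r s hrs => decay_antitone hb (by linarith))
          ((continuous_decay b).comp (by fun_prop)) fun s => decay_nonneg hb _
    _ ≤ ENNReal.ofReal (1 + ε) *
          (ENNReal.ofReal (1 + 2 * (Real.exp (b * t) - 1)) * decayMass b ν σ) := by
        gcongr
        exact h.lintegral_decay_sub_le hb ht ht1
    _ ≤ ENNReal.ofReal (1 + (ε + 8 * (b * t))) * decayMass b ν σ := by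
        rw [← mul_assoc, ← ENNReal.ofReal_mul (by positivity)]
        gcongr
        nlinarith

end HasGrowth

theorem decayKernel_le_smul {c : ℝ≥0∞} {w : Ω → ℝ≥0∞} (hν : ν ≤ H) (hc : (decayMass b ν σ)⁻¹ ≤ c)
    (hw : ∀ x, ENNReal.ofReal (decay b (σ x)) ≤ w x) :
    decayKernel b ν σ ≤ c • H.withDensity w := by
  refine Measure.le_iff.2 fun A hA => ?_
  rw [decayKernel, Measure.smul_apply, Measure.smul_apply, withDensity_apply _ hA,
    withDensity_apply _ hA]
  exact mul_le_mul' hc (lintegral_mono' (Measure.restrict_mono subset_rfl hν) hw)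

theorem exists_common_bound_of_decayMass_le (hν : ν ≤ H) (hν' : ν' ≤ H)
    (hmass : decayMass b ν σ ≤ decayMass b ν' σ') {B : ℝ≥0∞}
    (hmax : ∫⁻ x, max (ENNReal.ofReal (decay b (σ x))) (ENNReal.ofReal (decay b (σ' x))) ∂H ≤
      B * decayMass b ν σ) :
    ∃ G : Measure Ω, decayKernel b ν σ ≤ G ∧ decayKernel b ν' σ' ≤ G ∧ G Set.univ ≤ B := by
  refine ⟨(decayMass b ν σ)⁻¹ • H.withDensity fun x =>
    max (ENNReal.ofReal (decay b (σ x))) (ENNReal.ofReal (decay b (σ' x))),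
    decayKernel_le_smul hν le_rfl fun x => le_max_left _ _,
    decayKernel_le_smul hν' (ENNReal.inv_le_inv.2 hmass) fun x => le_max_right _ _, ?_⟩
  rw [Measure.smul_apply, withDensity_apply _ MeasurableSet.univ, Measure.restrict_univ,
    smul_eq_mul, mul_comm, ← div_eq_mul_inv]
  exact ENNReal.div_le_of_le_mul hmax

theorem HasGrowth.exists_common_bound (hb : 1 ≤ b) (ht : 0 ≤ t) (hε : 0 ≤ ε)
    (h : HasGrowth b ν σ) (h' : HasGrowth b ν' σ')
    (hH : ε ≤ 1 → ∃ H : Measure Ω, ν ≤ H ∧ ν' ≤ H ∧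
      (∀ s, H {x | σ x < s} ≤ ENNReal.ofReal (1 + ε) * ν {x | σ x < s}) ∧
      (∀ s, H {x | σ' x < s} ≤ ENNReal.ofReal (1 + ε) * ν' {x | σ' x < s}))
    (hσ : ∀ x, σ' x < 3 → σ x ≤ σ' x + t) (hσ' : ∀ x, σ x < 3 → σ' x ≤ σ x + t) :
    ∃ G : Measure Ω, decayKernel b ν σ ≤ G ∧ decayKernel b ν' σ' ≤ G ∧
      G Set.univ ≤ ENNReal.ofReal (1 + (ε + 8 * (b * t))) := by
  have hb0 : 0 < b := by linarith
  have hbt0 : 0 ≤ b * t := mul_nonneg hb0.le ht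
  by_cases hsmall : ε ≤ 1 ∧ b * t ≤ 1
  · obtain ⟨hε1, hbt⟩ := hsmall
    have ht1 : t ≤ 1 := (le_mul_of_one_le_left ht hb).trans hbt
    obtain ⟨H, hν, hν', hcmp, hcmp'⟩ := hH hε1
    have hmax := h.lintegral_max_decay_le hb0.le ht ht1 hbt hε hε1 hcmp hσ
    have hmax' := h'.lintegral_max_decay_le hb0.le ht ht1 hbt hε hε1 hcmp' hσ'
    rcases le_total (decayMass b ν σ) (decayMass b ν' σ') with hmass | hmass
    · exact exists_common_bound_of_decayMass_le hν hν' hmass hmax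
    · obtain ⟨G, hG', hG, hGuniv⟩ := exists_common_bound_of_decayMass_le hν' hν hmass hmax'
      exact ⟨G, hG, hG', hGuniv⟩
  · have := h.isProbabilityMeasure_decayKernel hb0
    have := h'.isProbabilityMeasure_decayKernel hb0
    have hlarge : 1 + 1 ≤ 1 + (ε + 8 * (b * t)) := by
      by_contra!
      exact hsmall ⟨by linarith, by linarith⟩
    refine ⟨decayKernel b ν σ + decayKernel b ν' σ', Measure.le_add_right le_rfl,
      Measure.le_add_left le_rfl, ?_⟩
    rw [Measure.add_apply, measure_univ, measure_univ, ← ENNReal.ofReal_one,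
      ← ENNReal.ofReal_add zero_le_one zero_le_one]
    exact ENNReal.ofReal_le_ofReal hlarge

end DecayKernel

section PiLpNorm

variable {ι : Type*} [Fintype ι]

theorem norm_toLp_one_eq_sum_abs (x : ι → ℝ) : ‖WithLp.toLp 1 x‖ = ∑ i, |x i| := by
  simpa only [Real.norm_eq_abs] using PiLp.norm_eq_of_L1 (WithLp.toLp 1 x)

theorem sum_mul_le_norm_toLp_one_mul_norm_toLp_top (x y : ι → ℝ) :
    ∑ i, x i * y i ≤ ‖WithLp.toLp 1 x‖ * ‖WithLp.toLp ⊤ y‖ := by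
  rw [norm_toLp_one_eq_sum_abs, Finset.sum_mul]
  refine Finset.sum_le_sum fun i _ => (le_abs_self _).trans ?_
  rw [abs_mul]
  gcongr
  exact PiLp.norm_apply_le (WithLp.toLp ⊤ y) i

theorem sum_mul_le_norm_toLp_mul_norm_toLp (p q : ℝ≥0∞) [p.HolderConjugate q] (x y : ι → ℝ) :
    ∑ i, x i * y i ≤ ‖WithLp.toLp p x‖ * ‖WithLp.toLp q y‖ := by
  by_cases hp : p = ⊤
  · obtain rfl := (ENNReal.HolderConjugate.eq_top_iff_eq_one p q).1 hp
    subst hp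
    simpa only [mul_comm] using sum_mul_le_norm_toLp_one_mul_norm_toLp_top y x
  by_cases hq : q = ⊤
  · obtain rfl := (ENNReal.HolderConjugate.eq_top_iff_eq_one q p).1 hq
    subst hq
    exact sum_mul_le_norm_toLp_one_mul_norm_toLp_top x y
  have hp0 : 0 < p.toReal := ENNReal.toReal_pos (ENNReal.HolderConjugate.ne_zero p q) hp
  have hq0 : 0 < q.toReal := ENNReal.toReal_pos (ENNReal.HolderConjugate.ne_zero q p) hq
  rw [PiLp.norm_eq_sum hp0, PiLp.norm_eq_sum hq0]
  have hpq := ENNReal.HolderTriple.toReal (r := 1) hp0 hq0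
  rw [ENNReal.toReal_one] at hpq
  exact Real.inner_le_Lp_mul_Lq _ _ _ hpq

variable (p : ℝ≥0∞) [Fact (1 ≤ p)]

theorem norm_toLp_mono {x y : ι → ℝ} (h : ∀ i, |x i| ≤ |y i|) :
    ‖WithLp.toLp p x‖ ≤ ‖WithLp.toLp p y‖ := by
  rcases eq_or_ne p ⊤ with rfl | hp
  · rw [PiLp.norm_eq_ciSup, PiLp.norm_eq_ciSup]
    exact ciSup_mono (Set.finite_range _).bddAbove h
  · have hp0 : 0 < p.toReal :=
      ENNReal.toReal_pos (zero_lt_one.trans_le (Fact.out : 1 ≤ p)).ne' hp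
    rw [PiLp.norm_eq_sum hp0, PiLp.norm_eq_sum hp0]
    gcongr with i
    exact h i

theorem norm_toLp_le_sum_abs (x : ι → ℝ) : ‖WithLp.toLp p x‖ ≤ ∑ i, |x i| := by
  classical
  have hx : WithLp.toLp p x = ∑ i, PiLp.single p i (x i) := by
    ext j
    simp [WithLp.ofLp_sum]
  rw [hx]
  refine (norm_sum_le _ _).trans (Finset.sum_le_sum fun i _ => ?_)
  rw [PiLp.norm_single, Real.norm_eq_abs]

theorem dist_eq_norm_toLp_dist {M : ι → Type*} [∀ i, MetricSpace (M i)] (x y : PiLp p M) :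
    dist x y = ‖WithLp.toLp p fun i => dist (x i) (y i)‖ := by
  rcases eq_or_ne p ⊤ with rfl | hp
  · rw [PiLp.norm_eq_ciSup, PiLp.dist_eq_iSup]
    simp only [Real.norm_of_nonneg dist_nonneg]
  · have hp0 : 0 < p.toReal :=
      ENNReal.toReal_pos (zero_lt_one.trans_le (Fact.out : 1 ≤ p)).ne' hp
    rw [PiLp.norm_eq_sum hp0, PiLp.dist_eq_sum hp0]
    simp only [Real.norm_of_nonneg dist_nonneg]

theorem measurable_norm_toLp {Ω : Type*} [MeasurableSpace Ω] {f : Ω → ι → ℝ}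
    (hf : ∀ i, Measurable fun x => f x i) : Measurable fun x => ‖WithLp.toLp p (f x)‖ :=
  (PiLp.continuous_toLp p fun _ : ι => ℝ).norm.measurable.comp (measurable_pi_lambda _ hf)

end PiLpNorm

section ProductMeasure

variable {ι : Type*} [Fintype ι] {M : ι → Type*} [∀ i, MeasurableSpace (M i)]

theorem measure_pi_le_of_slice_le [DecidableEq ι] (i : ι) {μ μ' : ∀ i, Measure (M i)}
    [∀ i, SigmaFinite (μ i)] [∀ i, SigmaFinite (μ' i)] (hμ : ∀ j ≠ i, μ j = μ' j)
    {A B : Set (∀ i, M i)} (hA : MeasurableSet A) (hB : MeasurableSet B) {c : ℝ≥0∞} (hc : c ≠ ⊤)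
    (h : ∀ x, μ i (Function.update x i ⁻¹' A) ≤ c * μ' i (Function.update x i ⁻¹' B)) :
    Measure.pi μ A ≤ c * Measure.pi μ' B := by
  rcases isEmpty_or_nonempty (∀ i, M i) with _ | ⟨⟨x⟩⟩
  · simp only [Set.eq_empty_of_isEmpty A, measure_empty, zero_le]
  have hother : (fun j : Finset.univ.erase i => μ j) = fun j : Finset.univ.erase i => μ' j :=
    funext fun j => hμ j (Finset.ne_of_mem_erase j.2)
  have hslice (θ : Measure (M i)) {E : Set (∀ i, M i)} (hE : MeasurableSet E) (x : ∀ i, M i) :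
      ∫⁻ y, E.indicator 1 (Function.update x i y) ∂θ = θ (Function.update x i ⁻¹' E) :=
    lintegral_indicator_one (measurable_update x hE)
  rw [← lintegral_indicator_one hA, ← lintegral_indicator_one hB,
    lintegral_eq_lmarginal_univ x, lintegral_eq_lmarginal_univ x,
    lmarginal_erase' _ (measurable_one.indicator hA) (Finset.mem_univ i),
    lmarginal_erase' _ (measurable_one.indicator hB) (Finset.mem_univ i),
    lmarginal, lmarginal, hother, ← lintegral_const_mul' _ _ hc]
  refine lintegral_mono fun y => ?_
  simp only [hslice _ hA, hslice _ hB]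
  exact h _

theorem measure_pi_le_prod_mul [DecidableEq ι] {η ν : ∀ i, Measure (M i)}
    [∀ i, SigmaFinite (η i)] [∀ i, SigmaFinite (ν i)] {c : ι → ℝ≥0∞} (hc : ∀ i, c i ≠ ⊤)
    {B : Finset ι → Set (∀ i, M i)} (hB : ∀ T, MeasurableSet (B T))
    (h : ∀ i T, i ∉ T → ∀ x, η i (Function.update x i ⁻¹' B (insert i T)) ≤
      c i * ν i (Function.update x i ⁻¹' B T)) :
    Measure.pi η (B Finset.univ) ≤ (∏ i, c i) * Measure.pi ν (B ∅) := by
  let mix (T : Finset ι) (i : ι) : Measure (M i) := if i ∈ T then η i else ν i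
  have hmix (T : Finset ι) (i : ι) : SigmaFinite (mix T i) := by
    by_cases hi : i ∈ T <;> simp only [mix, hi, if_true, if_false] <;> infer_instance
  have hind (T : Finset ι) :
      Measure.pi (mix T) (B T) ≤ (∏ i ∈ T, c i) * Measure.pi ν (B ∅) := by
    induction T using Finset.induction_on with
    | empty => simp [mix]
    | insert i T hi ih =>
      have hstep : Measure.pi (mix (insert i T)) (B (insert i T)) ≤
          c i * Measure.pi (mix T) (B T) := by
        refine measure_pi_le_of_slice_le i (fun j hj => ?_) (hB _) (hB _) (hc i) fun x => ?_
        · simp [mix, hj]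
        · simpa [mix, hi] using h i T hi x
      rw [Finset.prod_insert hi, mul_assoc]
      exact hstep.trans (by gcongr)
  simpa [mix] using hind Finset.univ

theorem measure_pi_mono {η ν : ∀ i, Measure (M i)} [∀ i, SigmaFinite (η i)]
    [∀ i, SigmaFinite (ν i)] (h : ∀ i, ν i ≤ η i) : Measure.pi ν ≤ Measure.pi η := by
  classical
  refine Measure.le_iff.2 fun A hA => ?_
  simpa only [Finset.prod_const_one, one_mul] using
    measure_pi_le_prod_mul (c := fun _ => 1) (B := fun _ => A) (fun _ => ENNReal.one_ne_top)
      (fun _ => hA) fun i _ _ x => by simpa only [one_mul] using h i _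

theorem measure_pi_preimage_le_of_sublevel_le {η ν : ∀ i, Measure (M i)} [∀ i, SigmaFinite (η i)]
    [∀ i, SigmaFinite (ν i)] {c : ι → ℝ≥0∞} (hc : ∀ i, c i ≠ ⊤) {t' t : ∀ i, M i → ℝ}
    (ht' : ∀ i, Measurable (t' i)) (ht : ∀ i, Measurable (t i))
    (h : ∀ i s, η i {y | t' i y < s} ≤ c i * ν i {y | t i y < s}) {U : Set (ι → ℝ)}
    (hU : IsOpen U) (hUl : IsLowerSet U) :
    Measure.pi η {x | (fun i => t' i (x i)) ∈ U} ≤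
      (∏ i, c i) * Measure.pi ν {x | (fun i => t i (x i)) ∈ U} := by
  classical
  let mix (T : Finset ι) (i : ι) : M i → ℝ := if i ∈ T then t' i else t i
  have hmix (T : Finset ι) (i : ι) : Measurable (mix T i) := by
    by_cases hi : i ∈ T <;> simp only [mix, hi, if_true, if_false]
    exacts [ht' i, ht i]
  have hslice (T : Finset ι) (i : ι) (x : ∀ i, M i) (y : M i) :
      (fun j => mix T j (Function.update x i y j)) =
        Function.update (fun j => mix T j (x j)) i (mix T i y) :=
    funext fun j => (Function.apply_update (mix T) x i y j)
  have hcompare := measure_pi_le_prod_mul (η := η) (ν := ν) hc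
    (B := fun T => {x | (fun i => mix T i (x i)) ∈ U})
    (fun T => measurable_pi_lambda _ (fun i => (hmix T i).comp (measurable_pi_apply i))
      hU.measurableSet) fun i T hi x => by
    set τ : ι → ℝ := fun j => mix T j (x j)
    have hτ (r : ℝ) : Function.update (fun j => mix (insert i T) j (x j)) i r =
        Function.update τ i r := by
      ext j
      rcases eq_or_ne j i with rfl | hj
      · simp only [Function.update_self]
      · simp [τ, mix, hj]
    have hopen : IsOpen (Function.update τ i ⁻¹' U) :=
      hU.preimage (continuous_const.update i continuous_id)
    have hlower : IsLowerSet (Function.update τ i ⁻¹' U) := fun r s hsr hr =>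
      hUl (Function.update_mono hsr) hr
    have hmem : mix (insert i T) i = t' i := if_pos (Finset.mem_insert_self i T)
    have hnotMem : mix T i = t i := if_neg hi
    simpa only [Set.preimage, Set.mem_ofPred_eq, hslice, hτ, hmem, hnotMem] using
      measure_preimage_le_of_sublevel_le (h i) hopen hlower
  simpa [mix] using hcompare

theorem isLowerSet_norm_toLp_posPart_lt (p : ℝ≥0∞) [Fact (1 ≤ p)] (s : ℝ) :
    IsLowerSet {v : ι → ℝ | ‖WithLp.toLp p v⁺‖ < s} := by
  intro v w hwv hv
  refine (norm_toLp_mono p fun i => ?_).trans_lt hv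
  rw [abs_of_nonneg (posPart_nonneg w i), abs_of_nonneg (posPart_nonneg v i)]
  exact posPart_mono hwv i

theorem measure_pi_norm_toLp_lt_le (p : ℝ≥0∞) [Fact (1 ≤ p)] {η ν : ∀ i, Measure (M i)}
    [∀ i, SigmaFinite (η i)] [∀ i, SigmaFinite (ν i)] {c : ι → ℝ≥0∞} (hc : ∀ i, c i ≠ ⊤)
    {t' t : ∀ i, M i → ℝ} (ht' : ∀ i, Measurable (t' i)) (ht : ∀ i, Measurable (t i))
    (ht'0 : ∀ i, 0 ≤ t' i) (ht0 : ∀ i, 0 ≤ t i)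
    (h : ∀ i s, 0 < s → η i {y | t' i y < s} ≤ c i * ν i {y | t i y < s}) (s : ℝ) :
    Measure.pi η {x | ‖WithLp.toLp p fun i => t' i (x i)‖ < s} ≤
      (∏ i, c i) * Measure.pi ν {x | ‖WithLp.toLp p fun i => t i (x i)‖ < s} := by
  have hposPart {f : ∀ i, M i → ℝ} (hf : ∀ i, 0 ≤ f i) (x : ∀ i, M i) :
      (fun i => f i (x i))⁺ = fun i => f i (x i) := posPart_of_nonneg fun i => hf i (x i)
  have hcompare (i : ι) (r : ℝ) : η i {y | t' i y < r} ≤ c i * ν i {y | t i y < r} := by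
    rcases lt_or_ge 0 r with hr | hr
    · exact h i r hr
    · have hempty : {y | t' i y < r} = ∅ :=
        Set.eq_empty_of_forall_notMem fun y hy => (hr.trans (ht'0 i y)).not_gt hy
      rw [hempty, measure_empty]
      exact zero_le
  have hcont : Continuous fun v : ι → ℝ => v⁺ :=
    continuous_pi fun i => (continuous_apply i).max continuous_const
  have hopen : IsOpen {v : ι → ℝ | ‖WithLp.toLp p v⁺‖ < s} :=
    isOpen_lt ((PiLp.continuous_toLp p fun _ : ι => ℝ).comp hcont).norm continuous_const
  simpa only [Set.mem_ofPred_eq, hposPart ht'0, hposPart ht0] using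
    measure_pi_preimage_le_of_sublevel_le hc ht' ht hcompare hopen
      (isLowerSet_norm_toLp_posPart_lt p s)

end ProductMeasure

section HomogeneousType

theorem le_add_measure_sub {Ω : Type*} [MeasurableSpace Ω] (μ ν : Measure Ω) [SigmaFinite μ]
    [SigmaFinite ν] : μ ≤ ν + (μ - ν) := by
  refine Measure.le_iff.2 fun A hA => ?_
  let B := spanningSets (μ + ν)
  have hmono : Monotone fun n => A ∩ B n := fun _ _ hmn =>
    Set.inter_subset_inter_right _ (monotone_spanningSets _ hmn)
  have hcover : ⋃ n, A ∩ B n = A := by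
    rw [← Set.inter_iUnion, iUnion_spanningSets, Set.inter_univ]
  have hfin (κ : Measure Ω) (hκ : κ ≤ μ + ν) (n : ℕ) : IsFiniteMeasure (κ.restrict (B n)) :=
    isFiniteMeasure_restrict.2 ((hκ _).trans_lt (measure_spanningSets_lt_top (μ + ν) n)).ne
  rw [← hcover, hmono.measure_iUnion, hcover]
  refine iSup_le fun n => ?_
  have := hfin μ (Measure.le_add_right le_rfl) n
  have := hfin ν (Measure.le_add_left le_rfl) n
  have hrestrict : μ.restrict (B n) ≤ ν.restrict (B n) + (μ - ν).restrict (B n) := by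
    rw [Measure.restrict_sub_eq_restrict_sub_restrict (measurableSet_spanningSets _ n), add_comm]
    exact Measure.sub_le_iff_le_add.1 le_rfl
  calc μ (A ∩ B n) = μ.restrict (B n) A := (Measure.restrict_apply hA).symm
    _ ≤ (ν.restrict (B n) + (μ - ν).restrict (B n)) A := hrestrict A
    _ ≤ (ν + (μ - ν)) A :=
        add_le_add (Measure.restrict_apply_le _ _) (Measure.restrict_apply_le _ _)

namespace IsPointwiseHomogeneous

variable {M : Type*} [MetricSpace M] [MeasurableSpace M] {μ : M → Measure M}

theorem sigmaFinite (h : IsPointwiseHomogeneous μ) (x : M) : SigmaFinite (μ x) :=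
  ⟨⟨{ set := fun n => ball x (n + 1)
      set_mem := fun _ => trivial
      finite := fun n => (h.doublingAt x).finite _ (by positivity)
      spanning := by
        refine Set.eq_univ_of_forall fun y => Set.mem_iUnion.2 ?_
        obtain ⟨n, hn⟩ := exists_nat_gt (dist y x)
        exact ⟨n, by rw [mem_ball]; linarith⟩ }⟩⟩

theorem measure_ball_two_mul_le (h : IsPointwiseHomogeneous μ) (x : M) {R : ℝ} (hR : 0 < R) :
    μ x (ball x (2 * R)) ≤ doublingConst μ * μ x (ball x R) := by
  have hquot : μ x (ball x (2 * R)) / μ x (ball x R) ≤ doublingConst μ :=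
    (le_iSup₂ (f := fun (R : ℝ) (_ : 0 < R) => μ x (ball x (2 * R)) / μ x (ball x R)) R hR).trans
      (le_iSup (fun m => doublingConstAt (μ m) m) x)
  exact (ENNReal.div_le_iff ((h.doublingAt x).pos R hR).ne'
    ((h.doublingAt x).finite R hR).ne).1 hquot

theorem measure_ball_two_pow_mul_le (h : IsPointwiseHomogeneous μ) (x : M) {R : ℝ} (hR : 0 < R)
    (k : ℕ) : μ x (ball x (2 ^ k * R)) ≤ doublingConst μ ^ k * μ x (ball x R) := by
  induction k with
  | zero => simp
  | succ k ih =>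
    rw [pow_succ', mul_assoc, pow_succ', mul_assoc]
    exact (h.measure_ball_two_mul_le x (by positivity)).trans (by gcongr)

theorem le_of_mul_measure_ball_le (h : IsPointwiseHomogeneous μ) {x : M} {R : ℝ} (hR : 0 < R)
    {a b : ℝ≥0∞} (hab : a * μ x (ball x R) ≤ b * μ x (ball x R)) : a ≤ b :=
  (ENNReal.mul_le_mul_iff_left ((h.doublingAt x).pos R hR).ne'
    ((h.doublingAt x).finite R hR).ne).1 hab

theorem one_le_doublingConst (h : IsPointwiseHomogeneous μ) (x : M) : 1 ≤ doublingConst μ := by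
  refine h.le_of_mul_measure_ball_le (x := x) one_pos ?_
  rw [one_mul]
  exact (measure_mono (ball_subset_ball (by norm_num))).trans (h.measure_ball_two_mul_le x one_pos)

theorem isConsistentWith_consistencyConst (h : IsPointwiseHomogeneous μ) :
    IsConsistentWith μ (consistencyConst μ) := by
  intro m₁ m₂ m R hm hR
  obtain ⟨C, -, hC, hCmem⟩ := exists_seq_tendsto_sInf (S := {C : ℝ≥0 | IsConsistentWith μ C})
    h.consistent (OrderBot.bddBelow _)
  have hne : μ m (ball m R) / ENNReal.ofReal R * edist m₁ m₂ ≠ ⊤ :=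
    ENNReal.mul_ne_top (ENNReal.div_ne_top ((h.doublingAt m).finite R hR).ne
      (ENNReal.ofReal_pos.2 hR).ne') (edist_ne_top _ _)
  rw [mul_assoc]
  refine ge_of_tendsto' (ENNReal.Tendsto.mul_const (ENNReal.tendsto_coe.2 hC) (Or.inr hne))
    fun n => ?_
  rw [← mul_assoc]
  exact hCmem n m₁ m₂ m R hm hR

theorem variationDiff_ball_le (h : IsPointwiseHomogeneous μ) (x y z : M) (hz : z = x ∨ z = y)
    {R : ℝ} (hR : 0 < R) : variationDiff (μ x) (μ y) (ball z R) ≤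
      ENNReal.ofReal (consistencyConst μ * dist x y / R) * μ z (ball z R) := by
  refine (h.isConsistentWith_consistencyConst x y z R hz hR).trans (le_of_eq ?_)
  rw [ENNReal.ofReal_div_of_pos hR, ENNReal.ofReal_mul (NNReal.coe_nonneg _),
    ENNReal.ofReal_coe_nnreal, edist_dist, div_eq_mul_inv, div_eq_mul_inv]
  ring

theorem variationDiff_ball_eq_zero (h : IsPointwiseHomogeneous μ) (hD : doublingConst μ < 2)
    (x y : M) {R : ℝ} (hR : 0 < R) : variationDiff (μ x) (μ y) (ball x R) = 0 := by
  set c : ℝ≥0∞ := ENNReal.ofReal (consistencyConst μ * dist x y / R) * μ x (ball x R) with hc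
  have hcne : c ≠ ⊤ := ENNReal.mul_ne_top ENNReal.ofReal_ne_top ((h.doublingAt x).finite R hR).ne
  have hbound (k : ℕ) : variationDiff (μ x) (μ y) (ball x R) ≤ (doublingConst μ / 2) ^ k * c := by
    have hscale : ENNReal.ofReal (consistencyConst μ * dist x y / (2 ^ k * R)) =
        ENNReal.ofReal (consistencyConst μ * dist x y / R) / 2 ^ k := by
      rw [mul_comm (2 ^ k) R, ← div_div, ENNReal.ofReal_div_of_pos (by positivity),
        ENNReal.ofReal_pow zero_le_two, ENNReal.ofReal_ofNat]
    have hsub : ball x R ⊆ ball x (2 ^ k * R) :=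
      ball_subset_ball (le_mul_of_one_le_left hR.le (one_le_pow₀ one_le_two))
    calc variationDiff (μ x) (μ y) (ball x R)
        ≤ variationDiff (μ x) (μ y) (ball x (2 ^ k * R)) :=
          add_le_add (measure_mono hsub) (measure_mono hsub)
      _ ≤ ENNReal.ofReal (consistencyConst μ * dist x y / R) / 2 ^ k *
            μ x (ball x (2 ^ k * R)) := by
          rw [← hscale]
          exact h.variationDiff_ball_le x y x (Or.inl rfl) (by positivity)
      _ ≤ ENNReal.ofReal (consistencyConst μ * dist x y / R) / 2 ^ k *
            (doublingConst μ ^ k * μ x (ball x R)) := by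
          gcongr
          exact h.measure_ball_two_pow_mul_le x hR k
      _ = (doublingConst μ / 2) ^ k * c := by
          simp only [hc, div_eq_mul_inv, mul_pow, ENNReal.inv_pow]
          ring
  have hlt : doublingConst μ / 2 < 1 := by
    rwa [ENNReal.div_lt_iff (Or.inl two_ne_zero) (Or.inl ENNReal.ofNat_ne_top), one_mul]
  have hlim := ENNReal.Tendsto.mul_const (b := c)
    (ENNReal.tendsto_pow_atTop_nhds_zero_of_lt_one hlt) (Or.inr hcne)
  rw [zero_mul] at hlim
  exact le_antisymm (ge_of_tendsto' hlim hbound) zero_le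

theorem measure_eq_of_doublingConst_lt_two (h : IsPointwiseHomogeneous μ)
    (hD : doublingConst μ < 2) (x y z : M) (r : ℝ) : μ x (ball z r) = μ y (ball z r) := by
  have hle (u v : M) : μ u (ball z r) ≤ μ v (ball z r) := by
    have := h.sigmaFinite u
    have := h.sigmaFinite v
    have hball : ball z r ⊆ ball u (|r| + dist z u + 1) :=
      ball_subset_ball' (by linarith [le_abs_self r])
    have hzero : (μ u - μ v) (ball z r) = 0 := measure_mono_null hball
      (add_eq_zero.1 (h.variationDiff_ball_eq_zero hD u v (by positivity))).1
    simpa only [Measure.add_apply, hzero, add_zero] using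
      le_add_measure_sub (μ u) (μ v) (ball z r)
  exact (hle x y).antisymm (hle y x)

theorem two_le_sq_doublingConst_of_measure_ball_le [OpensMeasurableSpace M]
    (h : IsPointwiseHomogeneous μ) {x y : M} (hxy : x ≠ y)
    (hle : μ x (ball x (dist x y / 2)) ≤ μ x (ball y (dist x y / 2))) :
    2 ≤ doublingConst μ ^ 2 := by
  have hr : 0 < dist x y / 2 := half_pos (dist_pos.2 hxy)
  set r := dist x y / 2 with hr_def
  refine h.le_of_mul_measure_ball_le (x := x) hr ?_
  calc 2 * μ x (ball x r) ≤ μ x (ball x r) + μ x (ball y r) := by rw [two_mul]; gcongr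
    _ = μ x (ball x r ∪ ball y r) :=
        (measure_union (ball_disjoint_ball (by linarith)) measurableSet_ball).symm
    _ ≤ μ x (ball x (2 ^ 2 * r)) := by
        refine measure_mono (Set.union_subset (ball_subset_ball (by linarith))
          (ball_subset_ball' ?_))
        rw [dist_comm y x]
        linarith
    _ ≤ doublingConst μ ^ 2 * μ x (ball x r) := h.measure_ball_two_pow_mul_le x hr 2

theorem two_le_sq_doublingConst [OpensMeasurableSpace M] (h : IsPointwiseHomogeneous μ) {x y : M}
    (hxy : x ≠ y) : 2 ≤ doublingConst μ ^ 2 := by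
  rcases lt_or_ge (doublingConst μ) 2 with hD | hD
  · rcases le_total (μ x (ball x (dist x y / 2))) (μ x (ball y (dist x y / 2))) with hle | hle
    · exact h.two_le_sq_doublingConst_of_measure_ball_le hxy hle
    · refine h.two_le_sq_doublingConst_of_measure_ball_le hxy.symm ?_
      rwa [dist_comm, h.measure_eq_of_doublingConst_lt_two hD y x,
        h.measure_eq_of_doublingConst_lt_two hD y x]
  · calc (2 : ℝ≥0∞) ≤ 2 ^ 2 := le_self_pow₀ one_le_two two_ne_zero
      _ ≤ doublingConst μ ^ 2 := by gcongr

theorem exists_upper_measure (h : IsPointwiseHomogeneous μ) (x y : M) :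
    ∃ η : Measure M, SigmaFinite η ∧ μ x ≤ η ∧ μ y ≤ η ∧ ∀ z, z = x ∨ z = y → ∀ R, 0 < R →
      η (ball z R) ≤
        ENNReal.ofReal (1 + consistencyConst μ * dist x y / R) * μ z (ball z R) := by
  have := h.sigmaFinite x
  have := h.sigmaFinite y
  have : SigmaFinite (μ x - μ y) := Measure.sigmaFinite_of_le (μ x) Measure.sub_le
  refine ⟨μ y + (μ x - μ y), inferInstance, le_add_measure_sub _ _, Measure.le_add_right le_rfl,
    fun z hz R hR => ?_⟩
  have hsum : (μ y + (μ x - μ y)) (ball z R) ≤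
      μ z (ball z R) + variationDiff (μ x) (μ y) (ball z R) := by
    rcases hz with rfl | rfl
    · rw [Measure.add_apply, variationDiff, add_comm ((μ z - μ y) _), ← add_assoc]
      gcongr
      simpa only [Measure.add_apply] using le_add_measure_sub (μ y) (μ z) (ball z R)
    · rw [Measure.add_apply, variationDiff]
      gcongr
      exact le_self_add
  rw [ENNReal.ofReal_add zero_le_one (by positivity), ENNReal.ofReal_one, add_mul, one_mul]
  exact hsum.trans (by gcongr; exact h.variationDiff_ball_le x y z hz hR)

theorem one_le_toReal_doublingConst (h : IsPointwiseHomogeneous μ) (x : M) :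
    1 ≤ (doublingConst μ).toReal := by
  simpa only [ENNReal.toReal_one] using
    ENNReal.toReal_mono h.uniform_doubling.ne (h.one_le_doublingConst x)

theorem half_le_logb_doublingConst [OpensMeasurableSpace M] (h : IsPointwiseHomogeneous μ)
    {x y : M} (hxy : x ≠ y) : 1 / 2 ≤ Real.logb 2 (doublingConst μ).toReal := by
  have hsq : (2 : ℝ) ≤ (doublingConst μ).toReal ^ 2 := by
    simpa only [ENNReal.toReal_ofNat, ENNReal.toReal_pow] using
      ENNReal.toReal_mono (ENNReal.pow_ne_top h.uniform_doubling.ne)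
        (h.two_le_sq_doublingConst hxy)
  have hlog := Real.logb_le_logb_of_le one_lt_two two_pos hsq
  rw [Real.logb_self_eq_one one_lt_two, Real.logb_pow, Nat.cast_ofNat] at hlog
  linarith

end IsPointwiseHomogeneous

end HomogeneousType

section TruncatedDistance

/-- The distance from `x` to `z` in units of `R`, reduced by `ℓ` but not below `0`. Its balls are
the balls of radius larger than `R * ℓ`, at which the consistency condition costs at most a multiple
of `(R * ℓ)⁻¹`. -/
def truncDist {E : Type*} [MetricSpace E] (ℓ R : ℝ) (x z : E) : ℝ :=
  max (dist x z / R - ℓ) 0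

variable {E : Type*} [MetricSpace E] {ℓ R : ℝ}

theorem truncDist_nonneg (ℓ R : ℝ) (x z : E) : 0 ≤ truncDist ℓ R x z :=
  le_max_right _ _

theorem truncDist_lt_iff (hR : 0 < R) {s : ℝ} (hs : 0 < s) (x z : E) :
    truncDist ℓ R x z < s ↔ z ∈ ball x (R * (s + ℓ)) := by
  rw [truncDist, max_lt_iff, and_iff_left hs, mem_ball', sub_lt_iff_lt_add, div_lt_iff₀ hR,
    mul_comm]

theorem measurable_truncDist [MeasurableSpace E] [BorelSpace E] (ℓ R : ℝ) (x : E) :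
    Measurable (truncDist ℓ R x) :=
  ((((continuous_const.dist continuous_id).div_const R).sub continuous_const).max
    continuous_const).measurable

theorem dist_le_mul_truncDist_add (hR : 0 < R) (x z : E) :
    dist x z ≤ R * (truncDist ℓ R x z + ℓ) := by
  rw [← div_le_iff₀' hR, ← sub_le_iff_le_add]
  exact le_max_left _ _

theorem truncDist_le_add {R' : ℝ} (hR : 0 < R) (hR' : 0 < R') (x x' z : E) :
    truncDist ℓ R x z ≤
      truncDist ℓ R' x' z + (R⁻¹ * dist x x' + |R' - R| / (R * R') * dist x' z) := by
  have hnonneg := truncDist_nonneg ℓ R' x' z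
  refine max_le ?_ (by positivity)
  have htrunc : dist x' z / R' - ℓ ≤ truncDist ℓ R' x' z := le_max_left _ _
  have hscale : dist x' z / R - dist x' z / R' ≤ |R' - R| / (R * R') * dist x' z := by
    calc dist x' z / R - dist x' z / R' = (R' - R) / (R * R') * dist x' z := by field_simp
      _ ≤ |R' - R| / (R * R') * dist x' z := by gcongr; exact le_abs_self _
  have htriangle : dist x z / R ≤ R⁻¹ * dist x x' + dist x' z / R := by
    rw [← div_eq_inv_mul, ← add_div]
    gcongr
    exact dist_triangle _ _ _
  linarith

end TruncatedDistance

section Gauge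

variable {ι : Type*} [Fintype ι] {M : ι → Type*} [∀ i, MetricSpace (M i)] {p : ℝ≥0∞}

/-- The `p`-norm of the truncated distances between the coordinates of `x` and `z`. The point `z`
is not taken in `PiLp p M` because the product measures live on the plain product. -/
def coordGauge (ℓ : ι → ℝ) (R : ℝ) (x : PiLp p M) (z : ∀ i, M i) : ℝ :=
  ‖WithLp.toLp p fun i => truncDist (ℓ i) R (x i) (z i)‖

variable [Fact (1 ≤ p)] {ℓ : ι → ℝ} {R : ℝ}

theorem dist_toLp_le_mul_coordGauge_add_one (hℓ : ∀ i, 0 ≤ ℓ i) (hℓ1 : ∑ i, ℓ i ≤ 1) (hR : 0 < R)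
    (x : PiLp p M) (z : ∀ i, M i) : dist x (WithLp.toLp p z) ≤ R * (coordGauge ℓ R x z + 1) := by
  set u : ι → ℝ := fun i => truncDist (ℓ i) R (x i) (z i)
  have hℓnorm : ‖WithLp.toLp p ℓ‖ ≤ 1 := by
    refine (norm_toLp_le_sum_abs p ℓ).trans ?_
    simpa only [abs_of_nonneg (hℓ _)] using hℓ1
  calc dist x (WithLp.toLp p z) = ‖WithLp.toLp p fun i => dist (x i) (z i)‖ :=
        dist_eq_norm_toLp_dist p x _
    _ ≤ ‖WithLp.toLp p (R • (u + ℓ))‖ := norm_toLp_mono p fun i => by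
        rw [abs_of_nonneg dist_nonneg]
        exact (dist_le_mul_truncDist_add hR _ _).trans (le_abs_self _)
    _ = R * ‖WithLp.toLp p u + WithLp.toLp p ℓ‖ := by
        rw [WithLp.toLp_smul, WithLp.toLp_add, norm_smul, Real.norm_of_nonneg hR.le]
    _ ≤ R * (coordGauge ℓ R x z + 1) := by
        gcongr
        exact (norm_add_le _ _).trans (add_le_add_right hℓnorm _)

theorem coordGauge_le_add_dist {R' : ℝ} (hR : 0 < R) (hR' : 0 < R') (x x' : PiLp p M)
    (z : ∀ i, M i) : coordGauge ℓ R x z ≤ coordGauge ℓ R' x' z +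
      (R⁻¹ * dist x x' + |R' - R| / (R * R') * dist x' (WithLp.toLp p z)) := by
  set u : ι → ℝ := fun i => truncDist (ℓ i) R' (x' i) (z i)
  set v : ι → ℝ := fun i => dist (x i) (x' i)
  set w : ι → ℝ := fun i => dist (x' i) (z i)
  calc coordGauge ℓ R x z ≤ ‖WithLp.toLp p (u + (R⁻¹ • v + (|R' - R| / (R * R')) • w))‖ :=
        norm_toLp_mono p fun i => by
          rw [abs_of_nonneg (truncDist_nonneg _ _ _ _)]
          exact (truncDist_le_add hR hR' _ _ _).trans (le_abs_self _)
    _ ≤ ‖WithLp.toLp p u‖ +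
        (‖R⁻¹ • WithLp.toLp p v‖ + ‖(|R' - R| / (R * R')) • WithLp.toLp p w‖) := by
        rw [WithLp.toLp_add, WithLp.toLp_add, WithLp.toLp_smul, WithLp.toLp_smul]
        exact (norm_add_le _ _).trans (add_le_add_right (norm_add_le _ _) _)
    _ = coordGauge ℓ R' x' z +
        (R⁻¹ * dist x x' + |R' - R| / (R * R') * dist x' (WithLp.toLp p z)) := by
        rw [norm_smul, norm_smul, Real.norm_of_nonneg (by positivity : 0 ≤ R⁻¹),
          Real.norm_of_nonneg (by positivity : 0 ≤ |R' - R| / (R * R')),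
          dist_eq_norm_toLp_dist p x x', dist_eq_norm_toLp_dist p x' (WithLp.toLp p z)]
        rfl

theorem coordGauge_le_add_of_lt_three (hℓ : ∀ i, 0 ≤ ℓ i) (hℓ1 : ∑ i, ℓ i ≤ 1) {R' : ℝ}
    (hR : 0 < R) (hR' : 0 < R') {x x' : PiLp p M} (hRR' : |R' - R| ≤ dist x x' / 4)
    {z : ∀ i, M i} (hz : coordGauge ℓ R' x' z < 3) :
    coordGauge ℓ R x z ≤ coordGauge ℓ R' x' z + 2 * (dist x x' / R) := by
  have hdist : dist x' (WithLp.toLp p z) ≤ R' * 4 :=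
    (dist_toLp_le_mul_coordGauge_add_one hℓ hℓ1 hR' x' z).trans (by gcongr; linarith)
  have hscale : |R' - R| / (R * R') * dist x' (WithLp.toLp p z) ≤ dist x x' / R := by
    calc |R' - R| / (R * R') * dist x' (WithLp.toLp p z)
        ≤ dist x x' / 4 / (R * R') * (R' * 4) := by gcongr
      _ = dist x x' / R := by field_simp
  refine (coordGauge_le_add_dist hR hR' x x' z).trans ?_
  rw [← div_eq_inv_mul]
  linarith

theorem coordGauge_lt_of_forall_truncDist_le {s : ℝ} (hs : 0 < s) {x : PiLp p M} {z : ∀ i, M i}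
    (h : ∀ i, truncDist (ℓ i) R (x i) (z i) ≤ s / (Fintype.card ι + 1)) :
    coordGauge ℓ R x z < s := by
  calc coordGauge ℓ R x z ≤ ∑ i, |truncDist (ℓ i) R (x i) (z i)| := norm_toLp_le_sum_abs p _
    _ ≤ ∑ _ : ι, s / (Fintype.card ι + 1) := Finset.sum_le_sum fun i _ => by
        rw [abs_of_nonneg (truncDist_nonneg _ _ _ _)]
        exact h i
    _ < s := by
        rw [Finset.sum_const, Finset.card_univ, nsmul_eq_mul, mul_div_left_comm]
        refine mul_lt_of_lt_one_right hs ?_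
        rw [div_lt_one (by positivity)]
        exact lt_add_one _

theorem truncDist_le_coordGauge (x : PiLp p M) (z : ∀ i, M i) (i : ι) :
    truncDist (ℓ i) R (x i) (z i) ≤ coordGauge ℓ R x z :=
  (le_abs_self _).trans
    (PiLp.norm_apply_le (WithLp.toLp p fun i => truncDist (ℓ i) R (x i) (z i)) i)

theorem prod_one_add_le {a : ι → ℝ} (ha : ∀ i, 0 ≤ a i) {A : ℝ} (hA : ∑ i, a i ≤ A)
    (hA1 : A ≤ 1) : ∏ i, (1 + a i) ≤ 1 + 2 * A := by
  have hA0 : 0 ≤ A := (Finset.sum_nonneg fun i _ => ha i).trans hA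
  have hexp := Real.abs_exp_sub_one_le (x := A) (by rwa [abs_of_nonneg hA0])
  rw [abs_of_nonneg hA0] at hexp
  calc ∏ i, (1 + a i) ≤ Real.exp (∑ i, a i) := Real.prod_one_add_le_exp_sum _ ha
    _ ≤ Real.exp A := Real.exp_le_exp.2 hA
    _ ≤ 1 + 2 * A := by linarith [le_abs_self (Real.exp A - 1)]

section Measurable

variable [∀ i, MeasurableSpace (M i)] [∀ i, BorelSpace (M i)]

theorem measurable_coordGauge (ℓ : ι → ℝ) (R : ℝ) (x : PiLp p M) : Measurable (coordGauge ℓ R x) :=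
  measurable_norm_toLp p fun i =>
    (measurable_truncDist (ℓ i) R (x i)).comp (measurable_pi_apply i)

theorem measure_pi_coordGauge_lt_le {η ν : ∀ i, Measure (M i)} [∀ i, SigmaFinite (η i)]
    [∀ i, SigmaFinite (ν i)] (hR : 0 < R) {x : PiLp p M} {a : ι → ℝ} (ha : ∀ i, 0 ≤ a i) {A : ℝ}
    (hA : ∑ i, a i ≤ A) (hA1 : A ≤ 1)
    (h : ∀ i s, 0 < s → η i (ball (x i) (R * (s + ℓ i))) ≤
      ENNReal.ofReal (1 + a i) * ν i (ball (x i) (R * (s + ℓ i)))) (s : ℝ) :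
    Measure.pi η {z | coordGauge ℓ R x z < s} ≤
      ENNReal.ofReal (1 + 2 * A) * Measure.pi ν {z | coordGauge ℓ R x z < s} := by
  refine (measure_pi_norm_toLp_lt_le p (c := fun i => ENNReal.ofReal (1 + a i))
    (fun _ => ENNReal.ofReal_ne_top) (fun _ => measurable_truncDist _ _ _)
    (fun _ => measurable_truncDist _ _ _) (fun _ => truncDist_nonneg _ _ _)
    (fun _ => truncDist_nonneg _ _ _) (fun i s hs => ?_) s).trans (mul_le_mul_left ?_ _)
  · simp only [truncDist_lt_iff hR hs]
    exact h i s hs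
  · rw [← ENNReal.ofReal_prod_of_nonneg fun i _ => by linarith [ha i]]
    exact ENNReal.ofReal_le_ofReal (prod_one_add_le ha hA hA1)

end Measurable

variable [∀ i, MeasurableSpace (M i)] {μ : ∀ i, M i → Measure (M i)}
  (hμ : ∀ i, IsPointwiseHomogeneous (μ i))
include hμ

theorem measure_pi_coordGauge_lt_pos (hℓ : ∀ i, 0 ≤ ℓ i) (hR : 0 < R) (x : PiLp p M) {s : ℝ}
    (hs : 0 < s) : 0 < Measure.pi (fun i => μ i (x i)) {z | coordGauge ℓ R x z < s} := by
  have := fun i => (hμ i).sigmaFinite (x i)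
  set r : ℝ := s / (Fintype.card ι + 1)
  have hr0 : 0 < r := by positivity
  have hsub : Set.univ.pi (fun i => ball (x i) (R * (r + ℓ i))) ⊆ {z | coordGauge ℓ R x z < s} :=
    fun z hz => coordGauge_lt_of_forall_truncDist_le hs fun i =>
      ((truncDist_lt_iff hR hr0 _ _).2 (hz i trivial)).le
  refine lt_of_lt_of_le ?_ (measure_mono hsub)
  rw [Measure.pi_pi]
  exact CanonicallyOrderedAdd.prod_pos.2 fun i _ =>
    ((hμ i).doublingAt (x i)).pos _ (mul_pos hR (add_pos_of_pos_of_nonneg hr0 (hℓ i)))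

theorem measure_pi_coordGauge_lt_lt_top (hℓ : ∀ i, 0 ≤ ℓ i) (hR : 0 < R) (x : PiLp p M) {s : ℝ}
    (hs : 0 < s) : Measure.pi (fun i => μ i (x i)) {z | coordGauge ℓ R x z < s} < ⊤ := by
  have := fun i => (hμ i).sigmaFinite (x i)
  have hsub : {z | coordGauge ℓ R x z < s} ⊆ Set.univ.pi fun i => ball (x i) (R * (s + ℓ i)) :=
    fun z hz i _ => (truncDist_lt_iff hR hs _ _).1 ((truncDist_le_coordGauge x z i).trans_lt hz)
  refine (measure_mono hsub).trans_lt ?_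
  rw [Measure.pi_pi]
  exact ENNReal.prod_lt_top fun i _ =>
    ((hμ i).doublingAt (x i)).finite _ (mul_pos hR (add_pos_of_pos_of_nonneg hs (hℓ i)))

variable [∀ i, BorelSpace (M i)]

theorem measure_pi_coordGauge_lt_two_pow_mul_le (hℓ : ∀ i, 0 ≤ ℓ i) (hR : 0 < R) (x : PiLp p M)
    (k : ℕ) (s : ℝ) : Measure.pi (fun i => μ i (x i)) {z | coordGauge ℓ R x z < 2 ^ k * s} ≤
      (∏ i, doublingConst (μ i)) ^ k *
        Measure.pi (fun i => μ i (x i)) {z | coordGauge ℓ R x z < s} := by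
  have := fun i => (hμ i).sigmaFinite (x i)
  have hscale : {z : ∀ i, M i | coordGauge ℓ R x z < 2 ^ k * s} = {z |
      ‖WithLp.toLp p fun i => ((2 : ℝ) ^ k)⁻¹ * truncDist (ℓ i) R (x i) (z i)‖ < s} := by
    ext z
    have hnorm : ‖WithLp.toLp p fun i => ((2 : ℝ) ^ k)⁻¹ * truncDist (ℓ i) R (x i) (z i)‖ =
        ((2 : ℝ) ^ k)⁻¹ * coordGauge ℓ R x z := by
      rw [coordGauge, ← Real.norm_of_nonneg (by positivity : 0 ≤ ((2 : ℝ) ^ k)⁻¹), ← norm_smul,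
        Real.norm_of_nonneg (by positivity)]
      rfl
    rw [Set.mem_ofPred_eq, Set.mem_ofPred_eq, hnorm, inv_mul_lt_iff₀ (by positivity)]
  rw [hscale, ← Finset.prod_pow]
  refine measure_pi_norm_toLp_lt_le p (fun i => ENNReal.pow_ne_top (hμ i).uniform_doubling.ne)
    (fun i => (measurable_truncDist _ _ _).const_mul _) (fun i => measurable_truncDist _ _ _)
    (fun i z => mul_nonneg (by positivity) (truncDist_nonneg _ _ _ _))
    (fun i => truncDist_nonneg _ _ _) (fun i r hr => ?_) s
  have hpow : (1 : ℝ) ≤ 2 ^ k := one_le_pow₀ one_le_two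
  have hsub : {z | ((2 : ℝ) ^ k)⁻¹ * truncDist (ℓ i) R (x i) z < r} ⊆
      ball (x i) (2 ^ k * (R * (r + ℓ i))) := fun z hz => by
    have hz' : truncDist (ℓ i) R (x i) z < 2 ^ k * r := (inv_mul_lt_iff₀ (by positivity)).1 hz
    refine ball_subset_ball ?_ ((truncDist_lt_iff hR (by positivity) _ _).1 hz')
    nlinarith [mul_nonneg (mul_nonneg hR.le (hℓ i)) (sub_nonneg.2 hpow)]
  simp only [truncDist_lt_iff hR hr]
  exact (measure_mono hsub).trans ((hμ i).measure_ball_two_pow_mul_le (x i)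
    (mul_pos hR (add_pos_of_pos_of_nonneg hr (hℓ i))) k)

theorem hasGrowth_coordGauge (hℓ : ∀ i, 0 ≤ ℓ i) {b : ℝ}
    (hb : (∏ i, (doublingConst (μ i)).toReal) ^ 2 ≤ Real.exp (2 * b) - 1) (hR : 0 < R)
    (x : PiLp p M) : HasGrowth b (Measure.pi fun i => μ i (x i)) (coordGauge ℓ R x) where
  measurable := measurable_coordGauge ℓ R x
  pos := measure_pi_coordGauge_lt_pos hμ hℓ hR x one_pos
  finite := measure_pi_coordGauge_lt_lt_top hμ hℓ hR x four_pos
  growth := by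
    have hne : ∏ i, doublingConst (μ i) ≠ ⊤ :=
      (ENNReal.prod_lt_top fun i _ => (hμ i).uniform_doubling).ne
    have hprod : (∏ i, doublingConst (μ i)) ^ 2 ≤ ENNReal.ofReal (Real.exp (2 * b) - 1) := by
      rw [← ENNReal.ofReal_toReal hne, ← ENNReal.ofReal_pow ENNReal.toReal_nonneg,
        ENNReal.toReal_prod]
      exact ENNReal.ofReal_le_ofReal hb
    have hgrowth := measure_pi_coordGauge_lt_two_pow_mul_le hμ hℓ hR x 2 1
    norm_num only at hgrowth
    exact hgrowth.trans (by gcongr)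

end Gauge

theorem sq_le_exp_two_mul_logb_add_one_sub_one {D : ℝ} (hD : 1 ≤ D) :
    D ^ 2 ≤ Real.exp (2 * (Real.logb 2 D + 1)) - 1 := by
  have hD0 : 0 < D := zero_lt_one.trans_le hD
  have hlogb : Real.log D ≤ Real.logb 2 D :=
    le_div_self (Real.log_nonneg hD) (Real.log_pos one_lt_two)
      (by linarith [Real.log_two_lt_d9])
  have hsq : D ^ 2 ≤ Real.exp (2 * Real.logb 2 D) := by
    calc D ^ 2 = Real.exp (2 * Real.log D) := by
          rw [two_mul, Real.exp_add, Real.exp_log hD0, sq]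
      _ ≤ Real.exp (2 * Real.logb 2 D) := by gcongr
  have hone : 1 ≤ D ^ 2 := one_le_pow₀ hD
  have hexp : (2 : ℝ) + 1 ≤ Real.exp 2 := Real.add_one_le_exp 2
  rw [mul_add, mul_one, Real.exp_add]
  nlinarith

section LogShare

variable {ι : Type*} [Fintype ι] {M : ι → Type*} [∀ i, MetricSpace (M i)]
  [∀ i, MeasurableSpace (M i)] {p q : ℝ≥0∞} [Fact (1 ≤ p)]

/-- The rate of the exponential decay that dominates the growth of the product of the measures. -/
def decayRate (μ : ∀ i, M i → Measure (M i)) : ℝ :=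
  Real.logb 2 (∏ i, (doublingConst (μ i)).toReal) + 1

/-- The share of the `i`-th factor in the decay rate, used as the truncation level of the `i`-th
coordinate distance. The shares sum up to at most `1`, and the share of a factor with at least two
points is at least `(2 * decayRate μ)⁻¹`. -/
def logShare (μ : ∀ i, M i → Measure (M i)) (i : ι) : ℝ :=
  Real.logb 2 (doublingConst (μ i)).toReal / decayRate μ

variable {μ : ∀ i, M i → Measure (M i)} (hμ : ∀ i, IsPointwiseHomogeneous (μ i))
include hμ

theorem one_le_prod_toReal_doublingConst (x : ∀ i, M i) :
    1 ≤ ∏ i, (doublingConst (μ i)).toReal :=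
  Finset.one_le_prod fun i _ => (hμ i).one_le_toReal_doublingConst (x i)

theorem one_le_decayRate (x : ∀ i, M i) : 1 ≤ decayRate μ :=
  le_add_of_nonneg_left
    (Real.logb_nonneg one_lt_two (one_le_prod_toReal_doublingConst hμ x))

theorem logShare_nonneg (x : ∀ i, M i) (i : ι) : 0 ≤ logShare μ i :=
  div_nonneg (Real.logb_nonneg one_lt_two ((hμ i).one_le_toReal_doublingConst (x i)))
    (zero_le_one.trans (one_le_decayRate hμ x))

theorem sum_logShare_le_one (x : ∀ i, M i) : ∑ i, logShare μ i ≤ 1 := by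
  have hne (i : ι) (_ : i ∈ Finset.univ) : (doublingConst (μ i)).toReal ≠ 0 :=
    (zero_lt_one.trans_le ((hμ i).one_le_toReal_doublingConst (x i))).ne'
  simp only [logShare]
  rw [← Finset.sum_div, ← Real.logb_prod _ _ hne,
    div_le_one (zero_lt_one.trans_le (one_le_decayRate hμ x))]
  exact (lt_add_one _).le

variable [∀ i, BorelSpace (M i)]

theorem hasGrowth_coordGauge_logShare {R : ℝ} (hR : 0 < R) (x : PiLp p M) :
    HasGrowth (decayRate μ) (Measure.pi fun i => μ i (x i)) (coordGauge (logShare μ) R x) :=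
  hasGrowth_coordGauge hμ (logShare_nonneg hμ x)
    (sq_le_exp_two_mul_logb_add_one_sub_one (one_le_prod_toReal_doublingConst hμ x)) hR x

theorem consistencyConst_mul_dist_div_le (x y : ∀ i, M i) (i : ι) {R s : ℝ} (hR : 0 < R)
    (hs : 0 < s) : consistencyConst (μ i) * dist (x i) (y i) / (R * (s + logShare μ i)) ≤
      2 * decayRate μ / R * (consistencyConst (μ i) * dist (x i) (y i)) := by
  rcases eq_or_ne (x i) (y i) with hxy | hxy
  · simp [hxy]
  have hn : 0 < decayRate μ := zero_lt_one.trans_le (one_le_decayRate hμ x)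
  have hshare : 1 / 2 / decayRate μ ≤ s + logShare μ i :=
    (div_le_div_of_nonneg_right ((hμ i).half_le_logb_doublingConst hxy) hn.le).trans
      (le_add_of_nonneg_left hs.le)
  calc consistencyConst (μ i) * dist (x i) (y i) / (R * (s + logShare μ i))
      ≤ consistencyConst (μ i) * dist (x i) (y i) / (R * (1 / 2 / decayRate μ)) := by gcongr
    _ = 2 * decayRate μ / R * (consistencyConst (μ i) * dist (x i) (y i)) := by field_simp

theorem exists_pi_upper_measure [p.HolderConjugate q] (x y : PiLp p M) :
    ∃ H : Measure (∀ i, M i), Measure.pi (fun i => μ i (x i)) ≤ H ∧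
      Measure.pi (fun i => μ i (y i)) ≤ H ∧ ∀ z, z = x ∨ z = y → ∀ R A : ℝ, 0 < R →
        2 * decayRate μ / R * (‖WithLp.toLp q fun i => (consistencyConst (μ i) : ℝ)‖ * dist x y) ≤
          A → A ≤ 1 → ∀ s, H {w | coordGauge (logShare μ) R z w < s} ≤ ENNReal.ofReal (1 + 2 * A) *
            Measure.pi (fun i => μ i (z i)) {w | coordGauge (logShare μ) R z w < s} := by
  have hσ (z : PiLp p M) (i : ι) : SigmaFinite (μ i (z i)) := (hμ i).sigmaFinite (z i)
  have hn : 0 ≤ decayRate μ := zero_le_one.trans (one_le_decayRate hμ x)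
  choose η hηfin hxη hyη hη using fun i => (hμ i).exists_upper_measure (x i) (y i)
  refine ⟨Measure.pi η, measure_pi_mono hxη, measure_pi_mono hyη, fun z hz R A hR hA hA1 s => ?_⟩
  have hz' (i : ι) : z i = x i ∨ z i = y i := by
    rcases hz with rfl | rfl
    exacts [Or.inl rfl, Or.inr rfl]
  refine measure_pi_coordGauge_lt_le hR
    (a := fun i => 2 * decayRate μ / R * (consistencyConst (μ i) * dist (x i) (y i)))
    (fun i => by positivity) ?_ hA1 (fun i r hr => ?_) s
  · rw [dist_eq_norm_toLp_dist p x y] at hA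
    rw [← Finset.mul_sum]
    exact (mul_le_mul_of_nonneg_left (sum_mul_le_norm_toLp_mul_norm_toLp q p _ _)
      (by positivity)).trans hA
  · refine (hη i (z i) (hz' i) _
      (mul_pos hR (add_pos_of_pos_of_nonneg hr (logShare_nonneg hμ x i)))).trans ?_
    gcongr
    exact consistencyConst_mul_dist_div_le hμ x y i hR hr

theorem exists_common_bound_decayKernel_coordGauge [p.HolderConjugate q] {x y : PiLp p M}
    {R R' : ℝ} (hR : 0 < R) (hR' : 0 < R') (hRR' : R ≤ 4 / 3 * R')
    (hdist : |R' - R| ≤ dist x y / 4) :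
    ∃ G : Measure (∀ i, M i),
      decayKernel (decayRate μ) (Measure.pi fun i => μ i (x i))
        (coordGauge (logShare μ) R x) ≤ G ∧
      decayKernel (decayRate μ) (Measure.pi fun i => μ i (y i))
        (coordGauge (logShare μ) R' y) ≤ G ∧
      G Set.univ ≤ ENNReal.ofReal (1 + decayRate μ *
        (6 * ‖WithLp.toLp q fun i => (consistencyConst (μ i) : ℝ)‖ + 24) * (dist x y / R)) := by
  have : Fact (1 ≤ q) := ⟨ENNReal.HolderConjugate.one_le q p⟩
  set C : ℝ := ‖WithLp.toLp q fun i => (consistencyConst (μ i) : ℝ)‖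
  have hC0 : 0 ≤ C := norm_nonneg _
  have hn := one_le_decayRate hμ x
  have hn0 : 0 ≤ decayRate μ := zero_le_one.trans hn
  have hδ0 : 0 ≤ dist x y / R := by positivity
  have hδ' : dist x y / R' ≤ 4 / 3 * (dist x y / R) := by
    rw [← mul_div_assoc, div_le_div_iff₀ hR' hR]
    nlinarith [dist_nonneg (x := x) (y := y)]
  have hℓ := logShare_nonneg hμ x
  have hℓ1 := sum_logShare_le_one hμ x
  set A : ℝ := 3 * (decayRate μ * C * (dist x y / R))
  have hA0 : 0 ≤ A := by positivity
  rw [show decayRate μ * (6 * C + 24) * (dist x y / R) =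
    2 * A + 8 * (decayRate μ * (3 * (dist x y / R))) by ring]
  refine HasGrowth.exists_common_bound hn (by positivity) (by positivity)
    (hasGrowth_coordGauge_logShare hμ hR x) (hasGrowth_coordGauge_logShare hμ hR' y)
    (fun hε => ?_) (fun z hz => ?_) (fun z hz => ?_)
  · obtain ⟨H, hxH, hyH, hH⟩ := exists_pi_upper_measure (q := q) hμ x y
    refine ⟨H, hxH, hyH, hH x (Or.inl rfl) R A hR ?_ (by linarith),
      hH y (Or.inr rfl) R' A hR' ?_ (by linarith)⟩
    · calc 2 * decayRate μ / R * (C * dist x y) = 2 * (decayRate μ * C * (dist x y / R)) := by ring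
        _ ≤ A := by linarith
    · calc 2 * decayRate μ / R' * (C * dist x y) = 2 * (decayRate μ * C * (dist x y / R')) := by
            ring
        _ ≤ 2 * (decayRate μ * C * (4 / 3 * (dist x y / R))) := by gcongr
        _ = 8 / 9 * A := by ring
        _ ≤ A := by linarith
  · linarith [coordGauge_le_add_of_lt_three hℓ hℓ1 hR hR' hdist hz]
  · rw [dist_comm, abs_sub_comm] at hdist
    have hgauge := coordGauge_le_add_of_lt_three hℓ hℓ1 hR' hR hdist hz
    rw [dist_comm] at hgauge
    linarith

end LogShare

theorem extensionConst_empty (𝕜 X : Type*) {Y : Type*} [RCLike 𝕜] [MetricSpace Y]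
    [NormedAddCommGroup X] [NormedSpace 𝕜 X] : extensionConst 𝕜 X (∅ : Set Y) = 0 := by
  refine le_antisymm ?_ zero_le
  refine (iInf₂_le (0 : Lip 𝕜 (∅ : Set Y) X →L[𝕜] Lip 𝕜 Y X) fun f s => s.2.elim).trans ?_
  rw [norm_zero, ENNReal.ofReal_zero]

section ExtensionConst

variable {ι : Type*} [Fintype ι] {M : ι → Type*} [∀ i, MetricSpace (M i)]
  [∀ i, MeasurableSpace (M i)] [∀ i, BorelSpace (M i)] {p : ℝ≥0∞} [Fact (1 ≤ p)]
  {Y : Type*} [MetricSpace Y]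

/-- The probability measures which average the functions on `S` at the points `y ∉ closure S`: the
exponentially decaying density is taken at the scale `infDist y S / 16`, so that the mass lies
within `infDist y S / 4` of `y`. -/
def averagingKernel (μ : ∀ i, M i → Measure (M i)) (e : Y ≃ᵢ PiLp p M) (S : Set Y) (y : Y) :
    Measure (∀ i, M i) :=
  decayKernel (decayRate μ) (Measure.pi fun i => μ i (e y i))
    (coordGauge (logShare μ) (infDist y S / 16) (e y))

variable {μ : ∀ i, M i → Measure (M i)} (hμ : ∀ i, IsPointwiseHomogeneous (μ i))
  (e : Y ≃ᵢ PiLp p M) {S : Set Y}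
include hμ

theorem isProbabilityMeasure_averagingKernel {y : Y} (hy : 0 < infDist y S) :
    IsProbabilityMeasure (averagingKernel μ e S y) :=
  (hasGrowth_coordGauge_logShare hμ (by positivity) (e y)).isProbabilityMeasure_decayKernel
    (zero_lt_one.trans_le (one_le_decayRate hμ (e y)))

theorem isConcentratedNear_averagingKernel {y : Y} (hy : 0 < infDist y S) :
    IsConcentratedNear S (fun z => e.symm (WithLp.toLp p z)) y (averagingKernel μ e S y) := by
  have hR : 0 < infDist y S / 16 := by positivity
  filter_upwards [(hasGrowth_coordGauge_logShare hμ hR (e y)).ae_decayKernel_lt] with z hz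
  calc dist y (e.symm (WithLp.toLp p z)) = dist (e y) (WithLp.toLp p z) := by
        rw [← e.dist_eq, e.apply_symm_apply]
    _ ≤ infDist y S / 16 * (coordGauge (logShare μ) (infDist y S / 16) (e y) z + 1) :=
        dist_toLp_le_mul_coordGauge_add_one (logShare_nonneg hμ (e y))
          (sum_logShare_le_one hμ (e y)) hR _ _
    _ < infDist y S / 16 * (3 + 1) := by gcongr
    _ = infDist y S / 4 := by ring

theorem exists_common_bound_averagingKernel {q : ℝ≥0∞} [p.HolderConjugate q] {y y' : Y}
    (hy : 0 < infDist y S) (hy' : 0 < infDist y' S) (hyy' : dist y y' < infDist y S / 4) :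
    ∃ G : Measure (∀ i, M i), averagingKernel μ e S y ≤ G ∧ averagingKernel μ e S y' ≤ G ∧
      G Set.univ ≤ ENNReal.ofReal (1 + 96 * decayRate μ *
        (‖WithLp.toLp q fun i => (consistencyConst (μ i) : ℝ)‖ + 4) * dist y y' / infDist y S) := by
  have hle : infDist y S ≤ infDist y' S + dist y y' := infDist_le_infDist_add_dist
  have hle' : infDist y' S ≤ infDist y S + dist y' y := infDist_le_infDist_add_dist
  rw [dist_comm] at hle'
  obtain ⟨G, hG, hG', hGuniv⟩ := exists_common_bound_decayKernel_coordGauge (q := q) hμ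
    (x := e y) (y := e y') (R := infDist y S / 16) (R' := infDist y' S / 16) (by positivity)
    (by positivity) (by linarith) (by rw [e.dist_eq, abs_le]; constructor <;> linarith)
  refine ⟨G, hG, hG', hGuniv.trans_eq ?_⟩
  rw [e.dist_eq, div_div_eq_mul_div]
  ring_nf

end ExtensionConst

theorem mainTheorem3_general {ι : Type*} [Fintype ι] {M : ι → Type*} [∀ i, MetricSpace (M i)]
    [∀ i, MeasurableSpace (M i)] [∀ i, BorelSpace (M i)] {μ : ∀ i, M i → Measure (M i)}
    (hμ : ∀ i, IsPointwiseHomogeneous (μ i)) (p q : ℝ≥0∞) [Fact (1 ≤ p)] [p.HolderConjugate q]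
    {Y : Type*} [MetricSpace Y] (e : Y ≃ᵢ PiLp p M) (𝕜 X : Type*) [RCLike 𝕜]
    [NormedAddCommGroup X] [NormedSpace 𝕜 X] [CompleteSpace X] (S : Set Y) :
    extensionConst 𝕜 X S ≤ ENNReal.ofReal
      (7000 * (‖WithLp.toLp q fun i => (consistencyConst (μ i) : ℝ)‖ + 1) *
        (Real.logb 2 (∏ i, (doublingConst (μ i)).toReal) + 1)) := by
  rcases S.eq_empty_or_nonempty with rfl | hS
  · exact (extensionConst_empty 𝕜 X).trans_le zero_le
  obtain ⟨s, hs⟩ := hS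
  have : Fact (1 ≤ q) := ⟨ENNReal.HolderConjugate.one_le q p⟩
  have hn : 1 ≤ decayRate μ := one_le_decayRate hμ (e s)
  have hpos (y : Y) (hy : y ∉ closure S) : 0 < infDist y S :=
    (infDist_pos_iff_notMem_closure ⟨s, hs⟩).1 hy
  refine (extensionConst_le_of_kernels ⟨s, hs⟩ _ (averagingKernel μ e S)
    (fun y hy => isProbabilityMeasure_averagingKernel hμ e (hpos y hy))
    (fun y hy => isConcentratedNear_averagingKernel hμ e (hpos y hy)) (by positivity)
    fun y hy y' hy' => exists_common_bound_averagingKernel (q := q) hμ e (hpos y hy)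
      (hpos y' hy')).trans (ENNReal.ofReal_le_ofReal ?_)
  rw [← decayRate]
  nlinarith [norm_nonneg (WithLp.toLp q fun i => (consistencyConst (μ i) : ℝ)), hn]

theorem extensionConst_le_of_isPointwiseHomogeneous {M : Type*} [MetricSpace M]
    [MeasurableSpace M] [BorelSpace M] {μ : M → Measure M} (hμ : IsPointwiseHomogeneous μ)
    (𝕜 X : Type*) [RCLike 𝕜] [NormedAddCommGroup X] [NormedSpace 𝕜 X] [CompleteSpace X]
    (S : Set M) : extensionConst 𝕜 X S ≤ ENNReal.ofReal
      (7000 * (consistencyConst μ + 1) * (Real.logb 2 (doublingConst μ).toReal + 1)) := by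
  let e : M ≃ᵢ PiLp 1 fun _ : Fin 1 => M :=
    ⟨(Equiv.funUnique (Fin 1) M).symm.trans (WithLp.equiv 1 _).symm,
      Isometry.of_dist_eq fun x y => by
        rw [dist_eq_norm_toLp_dist, PiLp.norm_eq_of_L1]
        simp⟩
  have h := mainTheorem3_general (fun _ => hμ) 1 ⊤ e 𝕜 X S
  rw [PiLp.norm_eq_ciSup] at h
  simpa using h

end

theorem mainTheorem3 :
    ∃ c₀ : ℝ, 0 < c₀ ∧
      -- finite direct `p`-sums of spaces with uniform families of measures
      (∀ (N : ℕ) (M : Fin N → Type u) [∀ i, MetricSpace (M i)] [∀ i, MeasurableSpace (M i)]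
          [∀ i, BorelSpace (M i)] (μ : ∀ i, M i → Measure (M i)) (K : Fin N → ℝ≥0)
          (p q : ℝ≥0∞) [Fact (1 ≤ p)]
          (𝕜 : Type w) [RCLike 𝕜] (X : Type v) [NormedAddCommGroup X] [NormedSpace 𝕜 X]
          [CompleteSpace X] (S : Set (PiLp p M)),
          1 / p + 1 / q = 1 →
          (∀ i, IsPointwiseHomogeneous (μ i)) →
          (∀ i, 1 ≤ K i) →
          (∀ i, IsUniformFamily (μ i) (K i)) →
          extensionConst 𝕜 X S ≤
            ENNReal.ofReal
              (c₀ *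
                (‖(WithLp.toLp q fun i => (consistencyConst (μ i) : ℝ) :
                    PiLp q fun _ : Fin N => ℝ)‖ * (∏ i, (K i : ℝ)) + 1) *
                (Real.logb 2 (∏ i, (doublingConst (μ i)).toReal) + 1))) ∧
      -- a single space, without uniformity of the family of measures
      (∀ (M : Type u) [MetricSpace M] [MeasurableSpace M] [BorelSpace M] (μ : M → Measure M)
          (𝕜 : Type w) [RCLike 𝕜] (X : Type v) [NormedAddCommGroup X] [NormedSpace 𝕜 X]
          [CompleteSpace X] (S : Set M),
          IsPointwiseHomogeneous μ →
          extensionConst 𝕜 X S ≤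
            ENNReal.ofReal
              (c₀ * ((consistencyConst μ : ℝ) + 1) *
                (Real.logb 2 (doublingConst μ).toReal + 1))) := by
  refine ⟨7000, by norm_num, ?_, fun M _ _ _ μ 𝕜 _ X _ _ _ S hμ =>
    extensionConst_le_of_isPointwiseHomogeneous hμ 𝕜 X S⟩
  intro N M _ _ _ μ K p q _ 𝕜 _ X _ _ _ S hpq hμ hK _
  rw [one_div, one_div] at hpq
  have : p.HolderConjugate q := ENNReal.holderConjugate_iff.2 hpq
  have : Fact (1 ≤ q) := ⟨ENNReal.HolderConjugate.one_le q p⟩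
  rcases S.eq_empty_or_nonempty with rfl | ⟨y, -⟩
  · exact (extensionConst_empty 𝕜 X).trans_le zero_le
  have hD : 1 ≤ ∏ i, (doublingConst (μ i)).toReal := one_le_prod_toReal_doublingConst hμ y
  have hlog : 0 ≤ Real.logb 2 (∏ i, (doublingConst (μ i)).toReal) :=
    Real.logb_nonneg one_lt_two hD
  have hK1 : 1 ≤ ∏ i, (K i : ℝ) := Finset.one_le_prod fun i _ => hK i
  refine (mainTheorem3_general hμ p q (IsometryEquiv.refl _) 𝕜 X S).trans
    (ENNReal.ofReal_le_ofReal ?_)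
  gcongr
  exact le_mul_of_one_le_right (norm_nonneg _) hK1
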